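/- Rings are commutative with unit. A derivation $D$ of a ring $R$ is \emph{locally nilpotent} if for every $r\in R$ there is $n>0$ with $D^n(r)=0$; $R$ is \emph{rigid} if $0$ is its only locally nilpotent derivation, and \emph{non-rigid} otherwise. Let $B=\bigoplus_{i\in\mathbb Z}B_i$ be a $\mathbb Z$-graded integral domain. For $d\ge 1$ put $B^{(d)}=\bigoplus_{i\in\mathbb Z}B_{di}$, a subring of $B$. An element $f\in B$ is \emph{cylindrical} if it is nonzero and homogeneous of nonzero degree, and the degree-$0$ subring $B_{(f)}$ of the graded ring $B_f=B[1/f]$ is a polynomial ring in one variable over some subring of $B_{(f)}$. The \emph{saturation index} of $B$ is $e(B)=\gcd\{i\in\mathbb Z : B_i\neq 0\}$, and $B$ is \emph{saturated in codimension $1$} if $e(B/\mathfrak p)=e(B)$ for every homogeneous prime ideal $\mathfrak p$ of $B$ of height $1$, where $B/\mathfrak p$ carries the induced grading. \textbf{Theorem.} Let $B=\bigoplus_{i\in\mathbb Z}B_i$ be a $\mathbb Z$-graded integral domain that is finitely generated as an algebra over a field of characteristic $0$, and assume that at least one of the following holds: (i) the transcendence degree of $B$ over $B_0$ is at least $2$;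 (ii) there exist $i<0<j$ with $B_i\neq 0$ and $B_j\neq 0$. (1) The following are equivalent: (a) there exists $d\ge 1$ such that $B^{(d)}$ is non-rigid; (b) $B$ has a cylindrical element. (2) If $B$ is normal (integrally closed in its field of fractions) and saturated in codimension $1$, then (a) and (b) are also equivalent to: (c) $B$ is non-rigid. -/

import Mathlib

/-- A derivation `D : B → B` is locally nilpotent if each element is killed by some power of `D`. -/
def IsLocallyNilpotentDerivation {B : Type*} [CommRing B] (D : Derivation ℤ B B) : Prop :=
  ∀ b : B, ∃ n : ℕ, 0 < n ∧ (⇑D)^[n] b = 0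

/-- A ring is rigid if its only locally nilpotent derivation is zero. -/
def IsRigidRing (B : Type*) [CommRing B] : Prop :=
  ∀ D : Derivation ℤ B B, IsLocallyNilpotentDerivation D → D = 0

/-- `R` is a polynomial ring in one variable (over some subring of itself). -/
def IsPolynomialRingInOneVariable (R : Type*) [CommRing R] : Prop :=
  ∃ A : Subring R, Nonempty (R ≃ₐ[A] Polynomial A)

section Graded

variable {B : Type*} [CommRing B]

/-- The Veronese subring `B^(d) = ⨁ i, B_{di}` of a `ℤ`-graded ring `B`. -/
def veroneseSubring (𝒜 : ℤ → AddSubgroup B) [GradedRing 𝒜] (d : ℤ) : Subring B where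
  carrier := ((⨆ i : ℤ, 𝒜 (d * i) : AddSubgroup B) : Set B)
  zero_mem' := zero_mem (⨆ i : ℤ, 𝒜 (d * i))
  add_mem' := fun ha hb => add_mem (S := AddSubgroup B) ha hb
  neg_mem' := fun ha => neg_mem (S := AddSubgroup B) ha
  one_mem' := AddSubgroup.mem_iSup_of_mem 0 (by
    rw [mul_zero]; exact SetLike.GradedOne.one_mem)
  mul_mem' := by
    intro a b ha hb
    change a ∈ (⨆ i : ℤ, 𝒜 (d * i)) at ha
    change b ∈ (⨆ i : ℤ, 𝒜 (d * i)) at hb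
    change a * b ∈ (⨆ i : ℤ, 𝒜 (d * i))
    induction ha using AddSubgroup.iSup_induction' with
    | hp i x hx =>
      induction hb using AddSubgroup.iSup_induction' with
      | hp j y hy =>
        refine AddSubgroup.mem_iSup_of_mem (i + j) ?_
        rw [mul_add]
        exact SetLike.GradedMul.mul_mem hx hy
      | h1 => rw [mul_zero]; exact zero_mem _
      | hadd y z _ _ hy hz => rw [mul_add]; exact add_mem hy hz
    | h1 => rw [zero_mul]; exact zero_mem _
    | hadd x y _ _ hx hy => rw [add_mul]; exact add_mem hx hy

/-- An element `f` of a `ℤ`-graded ring is cylindrical if it is nonzero, homogeneous of nonzero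
degree, and the degree-`0` subring `B_(f)` of `B_f` is a polynomial ring in one variable. -/
def IsCylindrical (𝒜 : ℤ → AddSubgroup B) [GradedRing 𝒜] (f : B) : Prop :=
  f ≠ 0 ∧ (∃ i : ℤ, i ≠ 0 ∧ f ∈ 𝒜 i) ∧
    IsPolynomialRingInOneVariable (HomogeneousLocalization.Away 𝒜 f)

/-- The saturation index `gcd {i ∈ ℤ | B_i ≠ 0}` of a grading, as the nonnegative generator of the
ideal of `ℤ` generated by the degrees that occur. -/
noncomputable def saturationIndex (𝒜 : ℤ → AddSubgroup B) : ℕ :=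
  (Submodule.IsPrincipal.generator (Ideal.span {i : ℤ | 𝒜 i ≠ ⊥})).natAbs

/-- The saturation index is the greatest common divisor of the degrees that occur. -/
theorem dvd_saturationIndex_iff (𝒜 : ℤ → AddSubgroup B) (m : ℤ) :
    m ∣ (saturationIndex 𝒜 : ℤ) ↔ ∀ i : ℤ, 𝒜 i ≠ ⊥ → m ∣ i := by
  rw [saturationIndex, Int.dvd_natAbs, ← Ideal.mem_span_singleton,
    ← Ideal.span_singleton_le_iff_mem, Ideal.span_singleton_generator, Ideal.span_le]
  simp only [Set.subset_def, Set.mem_ofPred_eq, SetLike.mem_coe, Ideal.mem_span_singleton]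

/-- The grading of `B / p` induced by that of `B`: `(B / p)_i` is the image of `B_i`. -/
def quotientGrading (𝒜 : ℤ → AddSubgroup B) (p : Ideal B) : ℤ → AddSubgroup (B ⧸ p) :=
  fun i => (𝒜 i).map (Ideal.Quotient.mk p).toAddMonoidHom

/-- `B` is saturated in codimension `1` if `e(B / p) = e(B)` for every homogeneous prime ideal `p`
of `B` of height `1`. -/
def IsSaturatedInCodimOne (𝒜 : ℤ → AddSubgroup B) [GradedRing 𝒜] : Prop :=
  ∀ p : Ideal B, p.IsPrime → p.IsHomogeneous 𝒜 → p.height = 1 →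
    saturationIndex (quotientGrading 𝒜 p) = saturationIndex 𝒜

end Graded

/-!
(a) ⇒ (b): the Veronese subring `V = B^(d)` is a finitely generated domain, so a suitable
homogeneous component of a nonzero locally nilpotent derivation of `V` is again nonzero and locally
nilpotent. Let `D` be such a homogeneous derivation. Each of (i) and (ii) forces `D` to kill a
nonzero homogeneous element of nonzero degree. After inverting a suitable homogeneous constant `f`
of nonzero degree, `D` acquires a homogeneous slice `s`, and the degree-zero part is the polynomial
ring over the degree-zero constants generated by `s ^ m / u`, where `u` is a homogeneous constant
unit and `m` is the least positive integer such that `s ^ m` has the same degree as a constant unit.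

(b) ⇒ (a): let `f` be cylindrical of degree `n` and `d = |n|`. In `B^(d)` every homogeneous element
is a power of `f` times an element of the degree-zero ring `A[t]`, so `∂/∂t`, extended by `f ↦ 0`,
is nilpotent on homogeneous elements; after multiplication by a power of `f` it preserves `B^(d)`.

(a) ⇒ (c): extend a homogeneous locally nilpotent derivation `E` of `B^(d)` to the fraction field.
If `E b ∉ B` for some homogeneous `b`, normality gives a prime `p` of height one containing all
denominators of `E b`. Saturation gives a homogeneous `z ∉ p` with `b z ∈ B^(d)`, and then
`d z ^ d E(b) = d z ^ (d - 1) E(b z) - b E(z ^ d)` shows that `d z ^ d` is a denominator. So `E`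
maps `B` to `B`, and it is locally nilpotent there because `d`-th powers of homogeneous elements lie
in `B^(d)` and the nilpotency degree satisfies `deg (x ^ d) = d deg x`.
-/

section Iterates

variable {S R : Type*} [CommRing S] [CommRing R] [Algebra S R] (D : Derivation S R R)

open Finset.HasAntidiagonal in
theorem iterate_derivation_mul (n : ℕ) (x y : R) :
    D^[n] (x * y) = ∑ ij ∈ antidiagonal n, n.choose ij.1 • (D^[ij.1] x * D^[ij.2] y) := by
  induction n with
  | zero => simp
  | succ n ih =>
    rw [Finset.sum_antidiagonal_choose_succ_nsmul (fun i j => D^[i] x * D^[j] y),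
      Function.iterate_succ_apply', ih]
    simp only [map_sum, map_nsmul, Derivation.leibniz, smul_eq_mul, ← Function.iterate_succ_apply',
      smul_add, Finset.sum_add_distrib, mul_comm (D^[_] y)]
    refine congrArg _ (Finset.sum_congr rfl fun ij hij => ?_)
    rw [n.choose_symm_of_eq_add (mem_antidiagonal.1 hij).symm]

variable {D}

theorem iterate_derivation_const_mul {c : R} (hc : D c = 0) (n : ℕ) (x : R) :
    D^[n] (c * x) = c * D^[n] x := by
  induction n with
  | zero => rfl
  | succ n ih => simp [Function.iterate_succ_apply', ih, hc]

theorem iterate_smul_derivation {c : R} (hc : D c = 0) (n : ℕ) (x : R) :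
    (c • D)^[n] x = c ^ n * D^[n] x := by
  induction n with
  | zero => simp
  | succ n ih =>
    rw [Function.iterate_succ_apply', ih, Function.iterate_succ_apply', Derivation.smul_apply,
      Derivation.leibniz, Derivation.leibniz_pow, hc]
    simp [pow_succ', mul_assoc]

theorem iterate_eq_zero_of_le {m n : ℕ} (hmn : m ≤ n) {x : R} (hx : D^[m] x = 0) :
    D^[n] x = 0 := by
  rw [← Nat.sub_add_cancel hmn, Function.iterate_add_apply, hx, iterate_map_zero]

variable (D) in
/-- `x` has degree `m` with respect to the degree function attached to a derivation `D` in the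
locally nilpotent theory: `D ^ m` is the last iterate that does not kill `x`. -/
def HasNilpotencyDegree (x : R) (m : ℕ) : Prop :=
  D^[m] x ≠ 0 ∧ D^[m + 1] x = 0

theorem exists_hasNilpotencyDegree {x : R} (hx : x ≠ 0) (h : ∃ n, D^[n] x = 0) :
    ∃ m, HasNilpotencyDegree D x m := by
  classical
  have hpos : Nat.find h ≠ 0 := fun h0 => hx (by simpa [h0] using Nat.find_spec h)
  obtain ⟨m, hm⟩ := Nat.exists_eq_succ_of_ne_zero hpos
  exact ⟨m, Nat.find_min h (by omega), by rw [← Nat.succ_eq_add_one, ← hm]; exact Nat.find_spec h⟩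

namespace HasNilpotencyDegree

variable {x y : R} {m n : ℕ}

theorem ne_zero (hx : HasNilpotencyDegree D x m) : x ≠ 0 := by
  rintro rfl
  exact hx.1 (iterate_map_zero D m)

theorem unique (hm : HasNilpotencyDegree D x m) (hn : HasNilpotencyDegree D x n) : m = n := by
  by_contra hne
  rcases lt_or_gt_of_ne hne with h | h
  · exact hn.1 (iterate_eq_zero_of_le h hm.2)
  · exact hm.1 (iterate_eq_zero_of_le h hn.2)

theorem of_apply_eq_zero (hx : x ≠ 0) (h : D x = 0) : HasNilpotencyDegree D x 0 :=
  ⟨hx, h⟩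

theorem apply_eq_zero (hx : HasNilpotencyDegree D x 0) : D x = 0 :=
  hx.2

theorem apply (hx : HasNilpotencyDegree D x (m + 1)) : HasNilpotencyDegree D (D x) m :=
  hx

open Finset.HasAntidiagonal in
theorem mul [IsDomain R] [CharZero R] (hx : HasNilpotencyDegree D x m)
    (hy : HasNilpotencyDegree D y n) : HasNilpotencyDegree D (x * y) (m + n) := by
  have hvanish : ∀ {i j : ℕ}, m < i ∨ n < j → D^[i] x * D^[j] y = 0 := by
    rintro i j (h | h)
    · rw [iterate_eq_zero_of_le h hx.2, zero_mul]
    · rw [iterate_eq_zero_of_le h hy.2, mul_zero]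
  constructor
  · rw [iterate_derivation_mul, Finset.sum_eq_single (m, n)]
    · rw [nsmul_eq_mul]
      exact mul_ne_zero (Nat.cast_ne_zero.2 (Nat.choose_pos (Nat.le_add_right m n)).ne')
        (mul_ne_zero hx.1 hy.1)
    · rintro ⟨i, j⟩ hij hne
      rw [mem_antidiagonal] at hij
      rw [hvanish (by grind), smul_zero]
    · exact fun h => (h (mem_antidiagonal.2 rfl)).elim
  · rw [iterate_derivation_mul]
    refine Finset.sum_eq_zero fun ⟨i, j⟩ hij => ?_
    rw [mem_antidiagonal] at hij
    rw [hvanish (by grind), smul_zero]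

theorem pow [IsDomain R] [CharZero R] (hx : HasNilpotencyDegree D x m) (n : ℕ) :
    HasNilpotencyDegree D (x ^ n) (n * m) := by
  induction n with
  | zero => simpa using of_apply_eq_zero (D := D) one_ne_zero D.map_one_eq_zero
  | succ n ih => simpa [pow_succ, add_mul] using ih.mul hx

end HasNilpotencyDegree

variable [IsDomain R] [CharZero R]

theorem apply_eq_zero_of_apply_mul_eq_zero {x y : R} (hx : ∃ n, D^[n] x = 0)
    (hy : ∃ n, D^[n] y = 0) (hxy : x * y ≠ 0) (h : D (x * y) = 0) : D x = 0 := by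
  obtain ⟨m, hm⟩ := exists_hasNilpotencyDegree (left_ne_zero_of_mul hxy) hx
  obtain ⟨n, hn⟩ := exists_hasNilpotencyDegree (right_ne_zero_of_mul hxy) hy
  have hmn : m + n = 0 := (hm.mul hn).unique (.of_apply_eq_zero hxy h)
  obtain rfl : m = 0 := by omega
  exact hm.apply_eq_zero

/-- The degree of `D x ^ d` is smaller than that of `x ^ d`, because
`d ^ d * (x ^ d) ^ (d - 1) * D x ^ d = D (x ^ d) ^ d`. -/
theorem HasNilpotencyDegree.lt_of_pow {d M M' : ℕ} (hd : d ≠ 0) {x : R}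
    (hx : HasNilpotencyDegree D (x ^ d) M) (hDx : HasNilpotencyDegree D (D x ^ d) M') :
    M' < M := by
  obtain ⟨d, rfl⟩ := Nat.exists_eq_succ_of_ne_zero hd
  have hd0 : ((d + 1 : ℕ) : R) ≠ 0 := Nat.cast_ne_zero.2 hd
  have hleibniz : D (x ^ (d + 1)) = ((d + 1 : ℕ) : R) * (x ^ d * D x) := by
    simp [Derivation.leibniz_pow]
  have hidentity : ((d + 1 : ℕ) : R) ^ (d + 1) * ((x ^ (d + 1)) ^ d * D x ^ (d + 1)) =
      D (x ^ (d + 1)) ^ (d + 1) := by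
    rw [hleibniz]
    ring
  obtain _ | M := M
  · have hx0 : x ≠ 0 := fun h => hx.ne_zero (by simp [h])
    have hDx0 : D x ≠ 0 := fun h => hDx.ne_zero (by simp [h])
    exact (mul_ne_zero hd0 (mul_ne_zero (pow_ne_zero d hx0) hDx0)
      (hleibniz ▸ hx.apply_eq_zero)).elim
  · have hconst : HasNilpotencyDegree D (((d + 1 : ℕ) : R) ^ (d + 1)) ((d + 1) * 0) :=
      (HasNilpotencyDegree.of_apply_eq_zero hd0 (D.map_natCast _)).pow _
    have hdegree := (hconst.mul ((hx.pow d).mul hDx)).unique (hidentity ▸ hx.apply.pow (d + 1))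
    nlinarith

theorem exists_iterate_eq_zero_of_pow {d : ℕ} (hd : d ≠ 0) {T : Set R}
    (hT : ∀ x ∈ T, D x ∈ T) (hpow : ∀ x ∈ T, ∃ n, D^[n] (x ^ d) = 0) :
    ∀ x ∈ T, ∃ n, D^[n] x = 0 := by
  suffices hdegree : ∀ M, ∀ x ∈ T, HasNilpotencyDegree D (x ^ d) M → ∃ n, D^[n] x = 0 by
    intro x hx
    rcases eq_or_ne x 0 with rfl | hx0
    · exact ⟨0, rfl⟩
    · obtain ⟨M, hM⟩ := exists_hasNilpotencyDegree (pow_ne_zero d hx0) (hpow x hx)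
      exact hdegree M x hx hM
  intro M
  induction M using Nat.strong_induction_on with
  | _ M ih =>
    intro x hx hM
    rcases eq_or_ne (D x) 0 with hDx | hDx
    · exact ⟨1, hDx⟩
    · obtain ⟨M', hM'⟩ := exists_hasNilpotencyDegree (pow_ne_zero d hDx) (hpow _ (hT x hx))
      obtain ⟨n, hn⟩ := ih M' (hM.lt_of_pow hd hM') (D x) (hT x hx) hM'
      exact ⟨n + 1, hn⟩

end Iterates

section Semiconj

variable {R S : Type*} [CommRing R] [CommRing S] {φ : R →+* S} {D : Derivation ℤ R R}
  {E : Derivation ℤ S S}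

theorem exists_derivation_semiconj (hφ : Function.Injective φ)
    (hE : ∀ r, E (φ r) ∈ φ.range) : ∃ D : Derivation ℤ R R, Function.Semiconj φ D E := by
  choose g hg using hE
  have hadd : ∀ a b, g (a + b) = g a + g b := fun a b => hφ (by simp only [hg, map_add])
  refine ⟨Derivation.mk' (AddMonoidHom.mk' g hadd).toIntLinearMap fun a b => hφ ?_, hg⟩
  change φ (g (a * b)) = φ (a * g b + b * g a)
  simp only [hg, map_mul, map_add, Derivation.leibniz, smul_eq_mul]

theorem IsLocallyNilpotentDerivation.of_semiconj (hφ : Function.Injective φ)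
    (h : Function.Semiconj φ D E) (hE : IsLocallyNilpotentDerivation E) :
    IsLocallyNilpotentDerivation D := by
  intro r
  obtain ⟨n, hn, hr⟩ := hE (φ r)
  exact ⟨n, hn, hφ (by rw [(h.iterate_right n).eq, hr, map_zero])⟩

theorem IsRigidRing.of_ringEquiv (e : R ≃+* S) (hR : IsRigidRing R) : IsRigidRing S := by
  intro E hE
  obtain ⟨D, hD⟩ := exists_derivation_semiconj (φ := (e : R →+* S)) (E := E) e.injective
    fun r => e.surjective _
  have hD0 : D = 0 := hR D (hE.of_semiconj e.injective hD)
  ext s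
  obtain ⟨r, rfl⟩ := e.surjective s
  simpa [hD0] using (hD r).symm

end Semiconj

section PolynomialRing

variable {R A : Type*} [CommRing R] [CommRing A]

theorem IsPolynomialRingInOneVariable.of_ringEquiv (e : R ≃+* Polynomial A) :
    IsPolynomialRingInOneVariable R := by
  let g : A →+* R := (e.symm : Polynomial A →+* R).comp Polynomial.C
  let e' : A ≃+* g.range :=
    RingEquiv.ofLeftInverse (f := g) (g := Polynomial.constantCoeff ∘ e) fun a => by simp [g]
  refine ⟨g.range, ⟨AlgEquiv.ofRingEquiv (f := e.trans (Polynomial.mapEquiv e')) fun r => ?_⟩⟩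
  obtain ⟨a, rfl⟩ := e'.surjective r
  have : algebraMap g.range R (e' a) = e.symm (Polynomial.C a) := rfl
  simp [this]

theorem exists_isLocallyNilpotentDerivation_ne_zero [Nontrivial R] (e : R ≃+* Polynomial A) :
    ∃ D : Derivation ℤ R R, IsLocallyNilpotentDerivation D ∧ D ≠ 0 := by
  let ddX : Derivation ℤ (Polynomial A) (Polynomial A) :=
    (Polynomial.derivative' (R := A)).restrictScalars ℤ
  have hddX : IsLocallyNilpotentDerivation ddX := fun p =>
    ⟨p.natDegree + 1, p.natDegree.succ_pos,
      Polynomial.iterate_derivative_eq_zero p.natDegree.lt_succ_self⟩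
  obtain ⟨D, hD⟩ := exists_derivation_semiconj (φ := (e : R →+* Polynomial A)) (E := ddX)
    e.injective fun r => e.surjective _
  refine ⟨D, hddX.of_semiconj e.injective hD, fun h0 => ?_⟩
  have hX : e (D (e.symm Polynomial.X)) = 1 := by
    refine (hD (e.symm Polynomial.X)).trans ?_
    change Polynomial.derivative (e (e.symm Polynomial.X)) = 1
    rw [e.apply_symm_apply, Polynomial.derivative_X]
  rw [h0, Derivation.coe_zero, Pi.zero_apply, map_zero] at hX
  exact zero_ne_one (e.injective (by rw [map_zero, map_one, hX]))

end PolynomialRing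

section Constants

variable {R : Type*} [CommRing R] (D : Derivation ℤ R R)

/-- The ring of constants (kernel) of a derivation. -/
def constantSubring : Subring R where
  carrier := {x | D x = 0}
  zero_mem' := map_zero D
  one_mem' := D.map_one_eq_zero
  add_mem' {x y} hx hy := by
    rw [Set.mem_ofPred_eq] at *
    rw [map_add, hx, hy, add_zero]
  neg_mem' {x} hx := by
    rw [Set.mem_ofPred_eq] at *
    rw [map_neg, hx, neg_zero]
  mul_mem' {x y} hx hy := by
    rw [Set.mem_ofPred_eq] at *
    rw [Derivation.leibniz, hx, hy, smul_zero, smul_zero, add_zero]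

variable {D}

theorem IsLocallyNilpotentDerivation.apply_algebraMap_eq_zero [IsDomain R] [CharZero R]
    (hD : IsLocallyNilpotentDerivation D) {k : Type*} [Field k] [Algebra k R] (c : k) :
    D (algebraMap k R c) = 0 := by
  rcases eq_or_ne c 0 with rfl | hc
  · rw [map_zero, map_zero]
  have hinv : algebraMap k R c * algebraMap k R c⁻¹ = 1 := by
    rw [← map_mul, mul_inv_cancel₀ hc, map_one]
  have hnilpotent : ∀ r, ∃ n, D^[n] r = 0 := fun r => (hD r).imp fun _ h => h.2
  exact apply_eq_zero_of_apply_mul_eq_zero (hnilpotent _) (hnilpotent _)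
    (by rw [hinv]; exact one_ne_zero) (by rw [hinv, D.map_one_eq_zero])

theorem apply_eq_zero_of_isAlgebraic [IsDomain R] [CharZero R] {A : Type*} [CommRing A]
    [Algebra A R] [FaithfulSMul A R] (hA : ∀ a, D (algebraMap A R a) = 0) {x : R}
    (hx : IsAlgebraic A x) : D x = 0 := by
  let DA : Derivation A R R := Derivation.mk'
    { toFun := D, map_add' := D.map_add, map_smul' := fun a y => by
        simp [Algebra.smul_def, Derivation.leibniz, hA] } D.leibniz
  have hinj := FaithfulSMul.algebraMap_injective A R
  have : IsDomain A := hinj.isDomain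
  have : CharZero A := ⟨fun a b h => Nat.cast_injective (R := R) (by
    simpa using congrArg (algebraMap A R) h)⟩
  by_contra hDx
  suffices hzero : ∀ n, ∀ p : Polynomial A, p.natDegree ≤ n → Polynomial.aeval x p = 0 → p = 0 by
    obtain ⟨p, hp, hpx⟩ := hx
    exact hp (hzero _ p le_rfl hpx)
  intro n
  induction n with
  | zero =>
    intro p hp hpx
    rw [Polynomial.eq_C_of_natDegree_le_zero hp, Polynomial.aeval_C] at hpx
    rw [Polynomial.eq_C_of_natDegree_le_zero hp, (map_eq_zero_iff _ hinj).1 hpx, map_zero]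
  | succ n ih =>
    intro p hp hpx
    have hderiv : Polynomial.aeval x p.derivative * D x = 0 := by
      have := DA.map_aeval p x
      rw [hpx, map_zero] at this
      exact this.symm
    have hp' := ih p.derivative ((Polynomial.natDegree_derivative_le p).trans (by omega))
      ((mul_eq_zero.1 hderiv).resolve_right hDx)
    rw [Polynomial.eq_C_of_derivative_eq_zero hp', Polynomial.aeval_C] at hpx
    rw [Polynomial.eq_C_of_derivative_eq_zero hp', (map_eq_zero_iff _ hinj).1 hpx, map_zero]

theorem exists_derivation_extending_of_isAlgebraic {K : Type*} [IsDomain R] [Field K] [CharZero K]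
    [Algebra R K] [FaithfulSMul R K] [Algebra.IsAlgebraic R K] (D : Derivation ℤ R K) :
    ∃ E : Derivation ℤ K K, ∀ r, E (algebraMap R K r) = D r := by
  let F := FractionRing R
  let _ : Algebra F K := FractionRing.liftAlgebra R K
  have : IsScalarTower R F K := FractionRing.isScalarTower_liftAlgebra R K
  have : CharZero F := (algebraMap F K).charZero
  have : Algebra.IsAlgebraic F K := (IsFractionRing.comap_isAlgebraic_iff (A := R) (K := F)).1 ‹_›
  have : Algebra.FormallyEtale F K := Algebra.FormallyEtale.of_isSeparable F K
  have : Algebra.FormallyEtale R F := Algebra.FormallyEtale.of_isLocalization (nonZeroDivisors R)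
  have : Algebra.FormallyEtale R K := Algebra.FormallyEtale.comp R F K
  have hbase := KaehlerDifferential.isBaseChange_of_formallyEtale ℤ R K
  refine ⟨(hbase.lift D.liftKaehlerDifferential).compDer (KaehlerDifferential.D ℤ K), fun r => ?_⟩
  have hlift := hbase.lift_eq D.liftKaehlerDifferential (KaehlerDifferential.D ℤ R r)
  rwa [KaehlerDifferential.map_D, Derivation.liftKaehlerDifferential_comp_D] at hlift

end Constants

section HomogeneousElements

variable {ι σ B : Type*} [DecidableEq ι] [AddMonoid ι] [CommRing B] [SetLike σ B]
  [AddSubgroupClass σ B] (𝒜 : ι → σ) [GradedRing 𝒜]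

open DirectSum

theorem eq_zero_of_sum_homogeneous_eq_zero {κ : Type*} {g : κ → ι} (hg : Function.Injective g)
    {s : Finset κ} {x : κ → B} (hx : ∀ i ∈ s, x i ∈ 𝒜 (g i)) (hsum : ∑ i ∈ s, x i = 0) :
    ∀ i ∈ s, x i = 0 := by
  intro i hi
  have hproj : GradedRing.proj 𝒜 (g i) (∑ j ∈ s, x j) = x i := by
    rw [map_sum, Finset.sum_eq_single_of_mem i hi fun j hj hji => ?_, GradedRing.proj_apply,
      decompose_of_mem_same _ (hx i hi)]
    rw [GradedRing.proj_apply, decompose_of_mem_ne _ (hx j hj) (hg.ne hji)]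
  rw [← hproj, hsum, map_zero]

variable {𝒜}

theorem mem_zero_of_one_add_mem [Nontrivial B] {x : B} {i j : ι} (hi : x ∈ 𝒜 i) (hj : 1 + x ∈ 𝒜 j) :
    x ∈ 𝒜 0 := by
  have hone : (1 : B) ∈ 𝒜 0 := SetLike.GradedOne.one_mem
  rcases eq_or_ne i 0 with rfl | hi0
  · exact hi
  obtain rfl : j = 0 := by
    by_contra hj0
    have hcomponent := decompose_of_mem_ne 𝒜 hj hj0
    rw [decompose_add, DirectSum.add_apply, AddMemClass.coe_add, decompose_of_mem_same 𝒜 hone,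
      decompose_of_mem_ne 𝒜 hi hi0, add_zero] at hcomponent
    exact one_ne_zero hcomponent
  simpa using sub_mem hj hone

variable [IsDomain B]

theorem add_eq_of_uniqueAdd_support [(i : ι) → (x : 𝒜 i) → Decidable (x ≠ 0)] {x y : B}
    {n a b : ι} (hxy : x * y ∈ 𝒜 n) (ha : a ∈ (decompose 𝒜 x).support)
    (hb : b ∈ (decompose 𝒜 y).support)
    (huniq : UniqueAdd (decompose 𝒜 x).support (decompose 𝒜 y).support a b) : a + b = n := by
  by_contra hne
  have hzero := decompose_of_mem_ne 𝒜 hxy (Ne.symm hne)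
  rw [decompose_mul, coe_mul_apply, Finset.sum_eq_single_of_mem (a, b)] at hzero
  · rw [DFinsupp.mem_support_iff] at ha hb
    exact mul_ne_zero (by simpa using ha) (by simpa using hb) hzero
  · exact Finset.mem_filter.2 ⟨Finset.mk_mem_product ha hb, rfl⟩
  · rintro ⟨a', b'⟩ h hne
    simp only [Finset.mem_filter, Finset.mem_product] at h
    obtain ⟨rfl, rfl⟩ := huniq h.1.1 h.1.2 h.2
    exact (hne rfl).elim

theorem isHomogeneousElem_of_mul [TwoUniqueSums ι] {x y : B}
    (hxy : SetLike.IsHomogeneousElem 𝒜 (x * y)) (h0 : x * y ≠ 0) :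
    SetLike.IsHomogeneousElem 𝒜 x := by
  classical
  obtain ⟨n, hn⟩ := hxy
  have hsupport : ∀ z : B, z ≠ 0 → 0 < (decompose 𝒜 z).support.card := by
    intro z hz
    rw [Finset.card_pos, Finset.nonempty_iff_ne_empty, Ne, DFinsupp.support_eq_empty]
    exact fun h => hz ((decompose 𝒜).injective (by rw [h, decompose_zero]))
  have hx := hsupport x (left_ne_zero_of_mul h0)
  have hy := hsupport y (right_ne_zero_of_mul h0)
  have hcard : (decompose 𝒜 x).support.card * (decompose 𝒜 y).support.card ≤ 1 := by
    by_contra! hcard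
    obtain ⟨p, hp, q, hq, hpq, hpu, hqu⟩ := TwoUniqueSums.uniqueAdd_of_one_lt_card hcard
    rw [Finset.mem_product] at hp hq
    have hsum := (add_eq_of_uniqueAdd_support hn hp.1 hp.2 hpu).trans
      (add_eq_of_uniqueAdd_support hn hq.1 hq.2 hqu).symm
    obtain ⟨h1, h2⟩ := hqu hp.1 hp.2 hsum
    exact hpq (Prod.ext h1 h2)
  obtain ⟨i, hi⟩ := Finset.card_eq_one.1 (by nlinarith : (decompose 𝒜 x).support.card = 1)
  refine ⟨i, ?_⟩
  rw [← sum_support_decompose 𝒜 x, hi, Finset.sum_singleton]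
  exact SetLike.coe_mem _

theorem algebraMap_mem_degree_zero [TwoUniqueSums ι] {k : Type*} [Field k] [Algebra k B] (c : k) :
    algebraMap k B c ∈ 𝒜 0 := by
  have hhom : ∀ c : k, SetLike.IsHomogeneousElem 𝒜 (algebraMap k B c) := by
    intro c
    rcases eq_or_ne c 0 with rfl | hc
    · exact ⟨0, by rw [map_zero]; exact zero_mem _⟩
    have hinv : algebraMap k B c * algebraMap k B c⁻¹ = 1 := by
      rw [← map_mul, mul_inv_cancel₀ hc, map_one]
    exact isHomogeneousElem_of_mul (hinv ▸ ⟨0, SetLike.GradedOne.one_mem⟩) (hinv ▸ one_ne_zero)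
  obtain ⟨i, hi⟩ := hhom c
  obtain ⟨j, hj⟩ := hhom (1 + c)
  rw [map_add, map_one] at hj
  exact mem_zero_of_one_add_mem hi hj

end HomogeneousElements

section Veronese

variable {B : Type*} [CommRing B] (𝒜 : ℤ → AddSubgroup B) [GradedRing 𝒜]

theorem mem_veroneseSubring_of_dvd {d i : ℤ} (hdi : d ∣ i) {x : B} (hx : x ∈ 𝒜 i) :
    x ∈ veroneseSubring 𝒜 d := by
  obtain ⟨j, rfl⟩ := hdi
  exact AddSubgroup.mem_iSup_of_mem j hx

theorem veroneseSubring_one : veroneseSubring 𝒜 1 = ⊤ := by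
  classical
  refine eq_top_iff.2 fun b _ => ?_
  rw [← DirectSum.sum_support_decompose 𝒜 b]
  exact sum_mem fun i _ => mem_veroneseSubring_of_dvd 𝒜 (one_dvd i) (SetLike.coe_mem _)

/-- The grading of the Veronese subring whose piece of degree `i` is `B_{di}`. -/
def veroneseGrading (d : ℤ) (i : ℤ) : AddSubgroup (veroneseSubring 𝒜 d) :=
  (𝒜 (d * i)).comap (veroneseSubring 𝒜 d).subtype.toAddMonoidHom

theorem mem_veroneseGrading {d i : ℤ} {x : veroneseSubring 𝒜 d} :
    x ∈ veroneseGrading 𝒜 d i ↔ (x : B) ∈ 𝒜 (d * i) := Iff.rfl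

theorem veroneseGrading_induction {d : ℤ} {motive : veroneseSubring 𝒜 d → Prop}
    (zero : motive 0) (add : ∀ x y, motive x → motive y → motive (x + y))
    (homogeneous : ∀ i, ∀ x ∈ veroneseGrading 𝒜 d i, motive x) (x : veroneseSubring 𝒜 d) :
    motive x := by
  obtain ⟨x, hx⟩ := x
  induction hx using AddSubgroup.iSup_induction' with
  | hp i x hx => exact homogeneous i ⟨x, mem_veroneseSubring_of_dvd 𝒜 ⟨i, rfl⟩ hx⟩ hx
  | h1 => exact zero
  | hadd x y _ _ hx hy => exact add _ _ hx hy

instance veroneseGrading_gradedMonoid (d : ℤ) : SetLike.GradedMonoid (veroneseGrading 𝒜 d) where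
  one_mem := by
    rw [mem_veroneseGrading, mul_zero]
    exact SetLike.GradedOne.one_mem
  mul_mem i j x y hx hy := by
    rw [mem_veroneseGrading, mul_add]
    exact SetLike.GradedMul.mul_mem hx hy

theorem veroneseGrading_isInternal {d : ℤ} (hd : d ≠ 0) :
    DirectSum.IsInternal (veroneseGrading 𝒜 d) := by
  classical
  constructor
  · rw [injective_iff_map_eq_zero]
    intro x hx
    rw [DirectSum.coeAddMonoidHom_eq_dfinsuppSum, DFinsupp.sum] at hx
    have hsum : ∑ i ∈ x.support, ((x i : veroneseSubring 𝒜 d) : B) = 0 := by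
      rw [← AddSubmonoidClass.coe_finsetSum, hx]; rfl
    ext i
    by_cases hi : i ∈ x.support
    · simpa using eq_zero_of_sum_homogeneous_eq_zero 𝒜 (mul_right_injective₀ hd)
        (fun i _ => (x i).2) hsum i hi
    · simp [DFinsupp.notMem_support_iff.1 hi]
  · intro x
    refine AddMonoidHom.mem_range.1 ?_
    induction x using veroneseGrading_induction with
    | zero => exact zero_mem _
    | add x y hx hy => exact add_mem hx hy
    | homogeneous i x hx =>
      exact ⟨DirectSum.of (fun i => veroneseGrading 𝒜 d i) i ⟨x, hx⟩, by simp⟩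

noncomputable instance veroneseGrading_gradedRing (d : ℤ) [NeZero d] :
    GradedRing (veroneseGrading 𝒜 d) :=
  { (veroneseGrading_gradedMonoid 𝒜 d),
    (veroneseGrading_isInternal 𝒜 (NeZero.ne d)).chooseDecomposition with }

theorem pow_mem_veroneseSubring {d : ℕ} {i : ℤ} {x : B} (hx : x ∈ 𝒜 i) :
    x ^ d ∈ veroneseSubring 𝒜 d :=
  mem_veroneseSubring_of_dvd 𝒜 ⟨i, nsmul_eq_mul d i⟩ (SetLike.pow_mem_graded d hx)

theorem veroneseSubring_isIntegral {d : ℕ} (hd : 1 ≤ d) :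
    Algebra.IsIntegral (veroneseSubring 𝒜 d) B := by
  classical
  refine ⟨fun b => ?_⟩
  rw [← DirectSum.sum_support_decompose 𝒜 b]
  exact IsIntegral.sum _ fun i _ => IsIntegral.of_pow hd (isIntegral_algebraMap
    (x := (⟨_, pow_mem_veroneseSubring 𝒜 (SetLike.coe_mem (DirectSum.decompose 𝒜 b i))⟩ :
      veroneseSubring 𝒜 d)))

variable [IsDomain B]

/-- The `k`-algebra structure of a Veronese subring; it exists because a field contained in a
`ℤ`-graded domain lies in degree zero. -/
noncomputable abbrev veroneseAlgebra (k : Type*) [Field k] [Algebra k B] (d : ℤ) :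
    Algebra k (veroneseSubring 𝒜 d) :=
  ((algebraMap k B).codRestrict (veroneseSubring 𝒜 d) fun c =>
    mem_veroneseSubring_of_dvd 𝒜 (dvd_zero d) (algebraMap_mem_degree_zero c)).toAlgebra

theorem veroneseSubring_finiteType (k : Type*) [Field k] [Algebra k B] [Algebra.FiniteType k B]
    {d : ℕ} (hd : 1 ≤ d) :
    letI := veroneseAlgebra 𝒜 k d
    Algebra.FiniteType k (veroneseSubring 𝒜 d) := by
  let _ := veroneseAlgebra 𝒜 k d
  have : IsScalarTower k (veroneseSubring 𝒜 d) B := IsScalarTower.of_algebraMap_eq fun _ => rfl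
  have := veroneseSubring_isIntegral 𝒜 hd
  have : Algebra.FiniteType (veroneseSubring 𝒜 d) B := .of_restrictScalars_finiteType k _ _
  have : Module.Finite (veroneseSubring 𝒜 d) B := Algebra.IsIntegral.finite
  exact ⟨fg_of_fg_of_fg k (veroneseSubring 𝒜 d) B Algebra.FiniteType.out Module.Finite.fg_top
    Subtype.val_injective⟩

end Veronese

section HomogeneousDerivations

open DirectSum

variable {R : Type*} [CommRing R] (ℛ : ℤ → AddSubgroup R)

/-- A derivation is homogeneous of degree `e` with respect to a family of additive subgroups
`ℛ i` when it maps `ℛ i` into `ℛ (i + e)`. The family is not required to span, so that the notion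
also applies to the homogeneous fractions inside a fraction field. -/
def IsHomogeneousDerivation (D : Derivation ℤ R R) (e : ℤ) : Prop :=
  ∀ i, ∀ x ∈ ℛ i, D x ∈ ℛ (i + e)

variable {ℛ} in
theorem IsHomogeneousDerivation.iterate_mem {D : Derivation ℤ R R} {e : ℤ}
    (hD : IsHomogeneousDerivation ℛ D e) {i : ℤ} {x : R} (hx : x ∈ ℛ i) (n : ℕ) :
    D^[n] x ∈ ℛ (i + n * e) := by
  induction n with
  | zero => simpa using hx
  | succ n ih =>
    rw [Function.iterate_succ_apply', show i + (n + 1 : ℕ) * e = i + n * e + e by push_cast; ring]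
    exact hD _ _ ih

variable [GradedRing ℛ]

theorem isLocallyNilpotentDerivation_of_homogeneous {D : Derivation ℤ R R}
    (h : ∀ i, ∀ x ∈ ℛ i, ∃ n : ℕ, D^[n] x = 0) : IsLocallyNilpotentDerivation D := by
  intro x
  suffices hx : ∃ n : ℕ, D^[n] x = 0 by
    obtain ⟨n, hn⟩ := hx
    exact ⟨n + 1, n.succ_pos, iterate_eq_zero_of_le n.le_succ hn⟩
  induction x using DirectSum.Decomposition.inductionOn ℛ with
  | zero => exact ⟨0, rfl⟩
  | homogeneous x => exact h _ _ x.2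
  | add x y hx hy =>
    obtain ⟨m, hm⟩ := hx
    obtain ⟨n, hn⟩ := hy
    refine ⟨max m n, ?_⟩
    rw [iterate_map_add, iterate_eq_zero_of_le (le_max_left m n) hm,
      iterate_eq_zero_of_le (le_max_right m n) hn, add_zero]

/-- The component of degree `e` of an additive endomorphism of a graded ring: on `ℛ i` it is the
component of degree `i + e` of the endomorphism. -/
def homogeneousComponentHom (D : R →+ R) (e : ℤ) : R →+ R :=
  (DirectSum.toAddMonoid fun i =>
    (GradedRing.proj ℛ (i + e)).comp (D.comp (ℛ i).subtype)).comp
    (decomposeAddEquiv ℛ).toAddMonoidHom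

theorem homogeneousComponentHom_apply (D : R →+ R) (e : ℤ) {i : ℤ} {x : R} (hx : x ∈ ℛ i) :
    homogeneousComponentHom ℛ D e x = decompose ℛ (D x) (i + e) := by
  simp [homogeneousComponentHom, decompose_of_mem ℛ hx]

variable (D : Derivation ℤ R R)

theorem homogeneousComponentHom_leibniz (e : ℤ) (x y : R) :
    homogeneousComponentHom ℛ (D : R →+ R) e (x * y) =
      x • homogeneousComponentHom ℛ (D : R →+ R) e y +
        y • homogeneousComponentHom ℛ (D : R →+ R) e x := by
  simp only [smul_eq_mul]
  induction x using DirectSum.Decomposition.inductionOn ℛ with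
  | zero => simp
  | add a b ha hb => rw [add_mul, map_add, ha, hb, map_add]; ring
  | @homogeneous i a =>
    induction y using DirectSum.Decomposition.inductionOn ℛ with
    | zero => simp
    | add b c hb hc => rw [mul_add, map_add, hb, hc, map_add]; ring
    | @homogeneous j b =>
      rw [homogeneousComponentHom_apply ℛ _ e (SetLike.GradedMul.mul_mem a.2 b.2),
        homogeneousComponentHom_apply ℛ _ e a.2, homogeneousComponentHom_apply ℛ _ e b.2]
      simp only [AddMonoidHom.coe_coe, Derivation.leibniz, decompose_add, DirectSum.add_apply,
        AddMemClass.coe_add, smul_eq_mul]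
      congr 1
      · rw [add_assoc, coe_decompose_mul_add_of_left_mem ℛ a.2]
      · rw [add_comm i j, add_assoc, coe_decompose_mul_add_of_left_mem ℛ b.2]

/-- The component of degree `e` of a derivation of a graded ring. -/
def derivationComponent (e : ℤ) : Derivation ℤ R R :=
  Derivation.mk' (homogeneousComponentHom ℛ (D : R →+ R) e).toIntLinearMap
    (homogeneousComponentHom_leibniz ℛ D e)

theorem derivationComponent_apply (e : ℤ) {i : ℤ} {x : R} (hx : x ∈ ℛ i) :
    derivationComponent ℛ D e x = decompose ℛ (D x) (i + e) :=
  homogeneousComponentHom_apply ℛ (D : R →+ R) e hx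

theorem derivationComponent_isHomogeneous (e : ℤ) :
    IsHomogeneousDerivation ℛ (derivationComponent ℛ D e) e := by
  intro i x hx
  rw [derivationComponent_apply ℛ D e hx]
  exact SetLike.coe_mem _

open Filter in
theorem eventually_derivationComponent_apply_eq_zero (x : R) :
    ∀ᶠ e in atTop, derivationComponent ℛ D e x = 0 := by
  classical
  induction x using DirectSum.Decomposition.inductionOn ℛ with
  | zero => simp
  | add a b ha hb =>
    filter_upwards [ha, hb] with e ha hb
    rw [map_add, ha, hb, add_zero]
  | @homogeneous i a =>
    obtain ⟨M, hM⟩ := (decompose ℛ (D a)).support.bddAbove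
    filter_upwards [eventually_gt_atTop (M - i)] with e he
    rw [derivationComponent_apply ℛ D e a.2, ZeroMemClass.coe_eq_zero]
    by_contra h
    have := hM (DFinsupp.mem_support_iff.2 h)
    omega

open Filter in
theorem eventually_derivationComponent_eq_zero {k : Type*} [CommRing k] [Algebra k R]
    [Algebra.FiniteType k R] (hk : ∀ c, algebraMap k R c ∈ ℛ 0)
    (hDk : ∀ c, D (algebraMap k R c) = 0) : ∀ᶠ e in atTop, derivationComponent ℛ D e = 0 := by
  obtain ⟨S, hS⟩ := (Algebra.FiniteType.out : (⊤ : Subalgebra k R).FG)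
  have hgenerators : ∀ᶠ e in atTop, ∀ s ∈ S, derivationComponent ℛ D e s = 0 :=
    (eventually_all_finset S).2 fun s _ => eventually_derivationComponent_apply_eq_zero ℛ D s
  filter_upwards [hgenerators] with e he
  ext x
  have hx : x ∈ Algebra.adjoin k (S : Set R) := hS ▸ Algebra.mem_top
  rw [Derivation.coe_zero, Pi.zero_apply]
  induction hx using Algebra.adjoin_induction with
  | mem x hx => exact he x hx
  | algebraMap c =>
    rw [derivationComponent_apply ℛ D e (hk c), hDk, decompose_zero, DirectSum.zero_apply,
      ZeroMemClass.coe_zero]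
  | add x y _ _ hx hy => rw [map_add, hx, hy, add_zero]
  | mul x y _ _ hx hy => rw [Derivation.leibniz, hx, hy, smul_zero, smul_zero, add_zero]

theorem decompose_derivation_eq_sum [∀ i (x : ℛ i), Decidable (x ≠ 0)] (j : ℤ) (y : R) :
    (decompose ℛ (D y) j : R) =
      ∑ l ∈ (decompose ℛ y).support, derivationComponent ℛ D (j - l) (decompose ℛ y l) := by
  conv_lhs => rw [← sum_support_decompose ℛ y]
  rw [map_sum, ← GradedRing.proj_apply, map_sum]
  refine Finset.sum_congr rfl fun l _ => ?_
  rw [derivationComponent_apply ℛ D _ (SetLike.coe_mem _), add_sub_cancel, GradedRing.proj_apply]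

theorem exists_derivationComponent_ne_zero (hD : D ≠ 0) : ∃ e, derivationComponent ℛ D e ≠ 0 := by
  classical
  by_contra! h
  refine hD (Derivation.ext fun x => ?_)
  rw [← sum_support_decompose ℛ (D x)]
  refine Finset.sum_eq_zero fun j _ => ?_
  rw [decompose_derivation_eq_sum]
  exact Finset.sum_eq_zero fun l _ => by rw [h, Derivation.coe_zero, Pi.zero_apply]

variable {D} {e : ℤ}

theorem decompose_derivation_eq_zero_of_lt (he : ∀ e', e < e' → derivationComponent ℛ D e' = 0)
    {j : ℤ} {x : R} (hx : ∀ l, j < l → decompose ℛ x l = 0) {l : ℤ} (hl : j + e < l) :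
    decompose ℛ (D x) l = 0 := by
  classical
  rw [← ZeroMemClass.coe_eq_zero, decompose_derivation_eq_sum]
  refine Finset.sum_eq_zero fun i hi => ?_
  have hij : i ≤ j := not_lt.1 fun h => DFinsupp.mem_support_iff.1 hi (hx i h)
  rw [he _ (by omega), Derivation.coe_zero, Pi.zero_apply]

theorem decompose_derivation_top (he : ∀ e', e < e' → derivationComponent ℛ D e' = 0)
    {j : ℤ} {x : R} (hx : ∀ l, j < l → decompose ℛ x l = 0) :
    (decompose ℛ (D x) (j + e) : R) = derivationComponent ℛ D e (decompose ℛ x j) := by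
  classical
  rw [decompose_derivation_eq_sum, Finset.sum_eq_single j, add_sub_cancel_left]
  · intro i hi hne
    have hij : i ≤ j := not_lt.1 fun h => DFinsupp.mem_support_iff.1 hi (hx i h)
    rw [he _ (by omega), Derivation.coe_zero, Pi.zero_apply]
  · intro hj
    rw [DFinsupp.notMem_support_iff.1 hj, ZeroMemClass.coe_zero, map_zero]

theorem iterate_derivationComponent_top (he : ∀ e', e < e' → derivationComponent ℛ D e' = 0)
    {i : ℤ} {x : R} (hx : x ∈ ℛ i) (n : ℕ) :
    (∀ l, i + n * e < l → decompose ℛ (D^[n] x) l = 0) ∧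
      (decompose ℛ (D^[n] x) (i + n * e) : R) = (derivationComponent ℛ D e)^[n] x := by
  induction n with
  | zero =>
    rw [Nat.cast_zero, zero_mul, add_zero, Function.iterate_zero_apply]
    exact ⟨fun l hl => Subtype.ext (decompose_of_mem_ne ℛ hx hl.ne), decompose_of_mem_same ℛ hx⟩
  | succ n ih =>
    rw [Function.iterate_succ_apply', Function.iterate_succ_apply', Nat.cast_succ, add_one_mul,
      ← add_assoc, decompose_derivation_top ℛ he ih.1, ih.2]
    exact ⟨fun l hl => decompose_derivation_eq_zero_of_lt ℛ he ih.1 hl, rfl⟩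

theorem IsLocallyNilpotentDerivation.derivationComponent_top
    (hD : IsLocallyNilpotentDerivation D)
    (he : ∀ e', e < e' → derivationComponent ℛ D e' = 0) :
    IsLocallyNilpotentDerivation (derivationComponent ℛ D e) := by
  refine isLocallyNilpotentDerivation_of_homogeneous ℛ fun i x hx => ?_
  obtain ⟨n, -, hn⟩ := hD x
  refine ⟨n, ?_⟩
  rw [← (iterate_derivationComponent_top ℛ he hx n).2, hn, decompose_zero, DirectSum.zero_apply,
    ZeroMemClass.coe_zero]

theorem IsLocallyNilpotentDerivation.exists_homogeneous {k : Type*} [Field k] [CharZero k]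
    [IsDomain R] [Algebra k R] [Algebra.FiniteType k R] (hD : IsLocallyNilpotentDerivation D)
    (hD0 : D ≠ 0) :
    ∃ (e : ℤ) (E : Derivation ℤ R R), E ≠ 0 ∧ IsLocallyNilpotentDerivation E ∧
      IsHomogeneousDerivation ℛ E e := by
  have : CharZero R := charZero_of_injective_algebraMap (algebraMap k R).injective
  obtain ⟨M, hM⟩ := Filter.eventually_atTop.1 (eventually_derivationComponent_eq_zero ℛ D
    (k := k) algebraMap_mem_degree_zero hD.apply_algebraMap_eq_zero)
  obtain ⟨e, he0, hmax⟩ := Int.exists_greatest_of_bdd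
    ⟨M, fun e he => (not_le.1 fun h => he (hM e h)).le⟩ (exists_derivationComponent_ne_zero ℛ D hD0)
  exact ⟨e, derivationComponent ℛ D e, he0, hD.derivationComponent_top ℛ fun e' he' =>
    not_not.1 fun h => (hmax e' h).not_gt he', derivationComponent_isHomogeneous ℛ D e⟩

end HomogeneousDerivations

section AwayPieces

variable {B : Type*} [CommRing B] {𝒜 : ℤ → AddSubgroup B} {K : Type*} [Field K] [Algebra B K]

section GradedMonoid

variable [SetLike.GradedMonoid 𝒜] {f : B} {n : ℤ}

variable (K) in
/-- The degree `i` part of the graded ring `B[1/f]`, for `f` homogeneous of degree `n`, realised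
inside a field `K` containing `B`: the elements `b / f ^ l` with `b` homogeneous of degree
`i + l * n`. Localizations at different elements then live in one field. -/
def awayPiece (hf : f ∈ 𝒜 n) (i : ℤ) : AddSubgroup K where
  carrier := {x | ∃ l : ℕ, ∃ b ∈ 𝒜 (i + l * n), x * algebraMap B K f ^ l = algebraMap B K b}
  zero_mem' := ⟨0, 0, zero_mem _, by simp⟩
  add_mem' := by
    rintro x y ⟨l, b, hb, hx⟩ ⟨m, c, hc, hy⟩
    refine ⟨l + m, b * f ^ m + c * f ^ l, add_mem ?_ ?_, ?_⟩
    · convert SetLike.GradedMul.mul_mem hb (SetLike.pow_mem_graded m hf) using 2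
      push_cast [nsmul_eq_mul]; ring
    · convert SetLike.GradedMul.mul_mem hc (SetLike.pow_mem_graded l hf) using 2
      push_cast [nsmul_eq_mul]; ring
    · rw [map_add, map_mul, map_mul, ← hx, ← hy, map_pow, map_pow]
      ring
  neg_mem' := by
    rintro x ⟨l, b, hb, hx⟩
    exact ⟨l, -b, neg_mem hb, by rw [map_neg, ← hx, neg_mul]⟩

variable (hf : f ∈ 𝒜 n)

theorem algebraMap_mem_awayPiece {i : ℤ} {b : B} (hb : b ∈ 𝒜 i) :
    algebraMap B K b ∈ awayPiece K hf i :=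
  ⟨0, b, by simpa using hb, by simp⟩

instance awayPiece_gradedMonoid : SetLike.GradedMonoid (awayPiece K hf) where
  one_mem := by
    rw [← map_one (algebraMap B K)]
    exact algebraMap_mem_awayPiece hf SetLike.GradedOne.one_mem
  mul_mem := by
    rintro i j x y ⟨l, b, hb, hx⟩ ⟨m, c, hc, hy⟩
    refine ⟨l + m, b * c, ?_, ?_⟩
    · convert SetLike.GradedMul.mul_mem hb hc using 2
      push_cast; ring
    · rw [map_mul, ← hx, ← hy]; ring

end GradedMonoid

variable [GradedRing 𝒜] {f : B} {n : ℤ} [FaithfulSMul B K]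

theorem div_mem_awayPiece [IsDomain B] (hf : f ∈ 𝒜 n) (hf0 : f ≠ 0) {x h : B} {i j : ℤ}
    (hx : x ∈ 𝒜 i) (hh : h ∈ 𝒜 j) (hdvd : h ∣ f) :
    algebraMap B K x / algebraMap B K h ∈ awayPiece K hf (i - j) := by
  obtain ⟨c, rfl⟩ := hdvd
  obtain ⟨l, hc⟩ := isHomogeneousElem_of_mul (𝒜 := 𝒜) (mul_comm h c ▸ ⟨n, hf⟩)
    (mul_comm h c ▸ hf0)
  have hn : n = j + l := DirectSum.degree_eq_of_mem_mem 𝒜 hf (SetLike.GradedMul.mul_mem hh hc) hf0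
  have hh0 : algebraMap B K h ≠ 0 :=
    (map_ne_zero_iff _ (FaithfulSMul.algebraMap_injective B K)).2 (left_ne_zero_of_mul hf0)
  refine ⟨1, x * c, ?_, ?_⟩
  · convert SetLike.GradedMul.mul_mem hx hc using 2
    rw [hn]; push_cast; ring
  · rw [pow_one, map_mul, ← mul_assoc, div_mul_cancel₀ _ hh0, map_mul]

theorem exists_injective_away_to_field (hf : f ∈ 𝒜 n) (hf0 : f ≠ 0) :
    ∃ φ : HomogeneousLocalization.Away 𝒜 f →+* K, Function.Injective φ ∧
      ∀ (l : ℕ) (b : B) (hb : b ∈ 𝒜 (l • n)),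
        φ (HomogeneousLocalization.Away.mk 𝒜 hf l b hb) * algebraMap B K f ^ l =
          algebraMap B K b := by
  have hinj := FaithfulSMul.algebraMap_injective B K
  have : IsDomain B := hinj.isDomain
  let g : Localization.Away f →+* K := IsLocalization.Away.lift f (g := algebraMap B K)
    (isUnit_iff_ne_zero.2 ((map_ne_zero_iff _ hinj).2 hf0))
  have hg : Function.Injective g := by
    refine (IsLocalization.lift_injective_iff _).2 fun x y => ?_
    rw [(IsLocalization.injective (Localization.Away f)
      (powers_le_nonZeroDivisors_of_noZeroDivisors hf0)).eq_iff, hinj.eq_iff]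
  refine ⟨g.comp (algebraMap _ (Localization.Away f)),
    hg.comp (HomogeneousLocalization.val_injective (𝒜 := 𝒜) (Submonoid.powers f)),
    fun l b hb => ?_⟩
  rw [RingHom.comp_apply, HomogeneousLocalization.algebraMap_apply,
    HomogeneousLocalization.Away.val_mk, Localization.mk_eq_mk', ← map_pow]
  exact (mul_comm _ _).trans
    ((IsLocalization.lift_mk'_spec _ _ _ (⟨f ^ l, l, rfl⟩ : Submonoid.powers f)).1 rfl).symm

variable (K) in
theorem nonempty_away_ringEquiv (hf : f ∈ 𝒜 n) (hf0 : f ≠ 0) :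
    Nonempty (HomogeneousLocalization.Away 𝒜 f ≃+*
      SetLike.GradeZero.subring (awayPiece K hf)) := by
  obtain ⟨φ, hφ, hmk⟩ := exists_injective_away_to_field (K := K) hf hf0
  have hf0' : algebraMap B K f ≠ 0 :=
    (map_ne_zero_iff _ (FaithfulSMul.algebraMap_injective B K)).2 hf0
  refine ⟨RingEquiv.ofBijective (φ.codRestrict _ fun x => ?_) ⟨?_, ?_⟩⟩
  · obtain ⟨l, b, hb, rfl⟩ := HomogeneousLocalization.Away.mk_surjective 𝒜 hf x
    exact ⟨l, b, by simpa using hb, hmk l b hb⟩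
  · exact fun x y h => hφ (congrArg Subtype.val h)
  · rintro ⟨x, l, b, hb, hx⟩
    have hb' : b ∈ 𝒜 (l • n) := by simpa using hb
    exact ⟨HomogeneousLocalization.Away.mk 𝒜 hf l b hb', Subtype.ext
      (mul_right_cancel₀ (pow_ne_zero l hf0') ((hmk l b hb').trans hx.symm))⟩

variable (K) in
theorem isPolynomialRingInOneVariable_away_iff (hf : f ∈ 𝒜 n) (hf0 : f ≠ 0) :
    IsPolynomialRingInOneVariable (HomogeneousLocalization.Away 𝒜 f) ↔
      IsPolynomialRingInOneVariable (SetLike.GradeZero.subring (awayPiece K hf)) := by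
  obtain ⟨e⟩ := nonempty_away_ringEquiv K hf hf0
  constructor
  · rintro ⟨A, ⟨h⟩⟩
    exact .of_ringEquiv (e.symm.trans h.toRingEquiv)
  · rintro ⟨A, ⟨h⟩⟩
    exact .of_ringEquiv (e.trans h.toRingEquiv)

theorem isPolynomialRingInOneVariable_away_veronese_iff [IsDomain B] {d : ℤ} [NeZero d]
    {f : veroneseSubring 𝒜 d} (hf : f ∈ veroneseGrading 𝒜 d n) (hf0 : f ≠ 0) :
    IsPolynomialRingInOneVariable (HomogeneousLocalization.Away (veroneseGrading 𝒜 d) f) ↔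
      IsPolynomialRingInOneVariable (HomogeneousLocalization.Away 𝒜 (f : B)) := by
  have hf0' : (f : B) ≠ 0 := fun h => hf0 (Subtype.ext h)
  have hf' : (f : B) ∈ 𝒜 (d * n) := hf
  let K := FractionRing B
  have : FaithfulSMul (veroneseSubring 𝒜 d) K := (faithfulSMul_iff_algebraMap_injective _ _).2
    ((FaithfulSMul.algebraMap_injective B K).comp Subtype.val_injective)
  rw [isPolynomialRingInOneVariable_away_iff K hf hf0,
    isPolynomialRingInOneVariable_away_iff K hf' hf0']
  have hring : SetLike.GradeZero.subring (awayPiece K hf) =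
      SetLike.GradeZero.subring (awayPiece K hf') := by
    have hdegree : ∀ l : ℕ, d * (0 + l * n) = 0 + l * (d * n) := fun l => by ring
    ext x
    constructor
    · rintro ⟨l, b, hb, hx⟩
      exact ⟨l, b, hdegree l ▸ (mem_veroneseGrading 𝒜).1 hb, hx⟩
    · rintro ⟨l, b, hb, hx⟩
      rw [← hdegree] at hb
      exact ⟨l, ⟨b, mem_veroneseSubring_of_dvd 𝒜 ⟨_, rfl⟩ hb⟩, hb, hx⟩
  rw [hring]

theorem IsCylindrical.of_veronese [IsDomain B] {d : ℤ} [NeZero d] {f : veroneseSubring 𝒜 d}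
    (h : IsCylindrical (veroneseGrading 𝒜 d) f) : IsCylindrical 𝒜 (f : B) := by
  obtain ⟨hf0, ⟨n, hn, hf⟩, hpoly⟩ := h
  exact ⟨fun h => hf0 (Subtype.ext h), ⟨d * n, mul_ne_zero (NeZero.ne d) hn, hf⟩,
    (isPolynomialRingInOneVariable_away_veronese_iff hf hf0).1 hpoly⟩

end AwayPieces

section GradedSlices

variable {S : Type*} [CommRing S] {P : ℤ → AddSubgroup S} [SetLike.GradedMonoid P]
  {δ : Derivation ℤ S S} {e : ℤ} {s : S}

theorem iterate_pow_localSlice {t : S} (ht : δ (δ t) = 0) (n : ℕ) :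
    δ^[n] (t ^ n) = n.factorial * δ t ^ n := by
  have hconst : ∀ n : ℕ, δ (((n + 1 : ℕ) : S) * δ t) = 0 := fun n => by
    rw [Derivation.leibniz, ht, δ.map_natCast, smul_zero, smul_zero, add_zero]
  induction n with
  | zero => simp
  | succ n ih =>
    rw [Function.iterate_succ_apply, Derivation.leibniz_pow, Nat.add_sub_cancel, smul_eq_mul,
      nsmul_eq_mul, mul_comm (t ^ n), ← mul_assoc, iterate_derivation_const_mul (hconst n), ih,
      Nat.factorial_succ, Nat.cast_mul]
    ring

theorem exists_eq_sum_const_mul_pow_slice [Algebra ℚ S] (hP : ∀ q : ℚ, algebraMap ℚ S q ∈ P 0)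
    (hδ : IsHomogeneousDerivation P δ e) (hs : s ∈ P (-e)) (hδs : δ s = 1) (N : ℕ) {i : ℤ} {x : S}
    (hx : x ∈ P i) (hxN : δ^[N] x = 0) :
    ∃ c : ℕ → S, (∀ j : ℕ, c j ∈ P (i + j * e) ∧ δ (c j) = 0) ∧
      x = ∑ j ∈ Finset.range N, c j * s ^ j := by
  induction N generalizing x with
  | zero => exact ⟨0, fun j => ⟨zero_mem _, map_zero δ⟩, by simpa using hxN⟩
  | succ N ih =>
    let a := (N.factorial : ℚ)⁻¹ • δ^[N] x
    have ha : a ∈ P (i + N * e) := by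
      simpa [a, Algebra.smul_def] using SetLike.GradedMul.mul_mem (hP (N.factorial : ℚ)⁻¹)
        (hδ.iterate_mem hx N)
    have hδa : δ a = 0 := by
      rw [map_rat_smul, (Function.iterate_succ_apply' δ N x).symm.trans hxN, smul_zero]
    have hax : a * s ^ N ∈ P i := by
      convert SetLike.GradedMul.mul_mem ha (SetLike.pow_mem_graded N hs) using 2
      rw [nsmul_eq_mul]; ring
    have hiter : δ^[N] (a * s ^ N) = δ^[N] x := by
      rw [iterate_derivation_const_mul hδa, iterate_pow_localSlice (by rw [hδs, δ.map_one_eq_zero]),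
        hδs, one_pow, mul_one, smul_mul_assoc, mul_comm, ← nsmul_eq_mul, ← Nat.cast_smul_eq_nsmul ℚ,
        inv_smul_smul₀ (Nat.cast_ne_zero.2 N.factorial_ne_zero)]
    obtain ⟨c, hc, hsum⟩ := ih (sub_mem hx hax) (by rw [iterate_map_sub, hiter, sub_self])
    refine ⟨Function.update c N a, fun j => ?_, ?_⟩
    · rcases eq_or_ne j N with rfl | hj
      · simpa using ⟨ha, hδa⟩
      · simpa [hj] using hc j
    · rw [Finset.sum_range_succ, Function.update_self, ← sub_eq_iff_eq_add, hsum]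
      exact Finset.sum_congr rfl fun j hj => by
        rw [Function.update_of_ne (Finset.mem_range.1 hj).ne]

theorem aeval_injective_of_apply_ne_zero [IsDomain S] [CharZero S] (T : Subring S) {t : T}
    (ht : δ t ≠ 0) :
    Function.Injective (Polynomial.aeval (R := (constantSubring δ).comap T.subtype) t) := by
  have htranscendental : Transcendental ((constantSubring δ).comap T.subtype) (t : S) :=
    fun h => ht (apply_eq_zero_of_isAlgebraic (fun a => a.2) h)
  intro p q hpq
  refine transcendental_iff_injective.1 htranscendental ?_
  change Polynomial.aeval (algebraMap T S t) p = Polynomial.aeval (algebraMap T S t) q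
  rw [Polynomial.aeval_algebraMap_apply, Polynomial.aeval_algebraMap_apply, hpq]

variable {m : ℕ} {u : Sˣ} (hu : (u : S) ∈ P (-(m * e))) (hδu : δ u = 0)

include hu hδu in
theorem exists_degree_zero_const_mul_slice_pow_eq {c : S} {q : ℕ}
    (hc : c ∈ P ((m * q : ℕ) * e)) (hδc : δ c = 0) :
    ∃ a ∈ P 0, δ a = 0 ∧ a * (s ^ m * ↑u⁻¹) ^ q = c * s ^ (m * q) := by
  refine ⟨c * u ^ q, ?_, by simp [Derivation.leibniz, Derivation.leibniz_pow, hδc, hδu], ?_⟩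
  · convert SetLike.GradedMul.mul_mem hc (SetLike.pow_mem_graded q hu) using 2
    push_cast [nsmul_eq_mul]; ring
  · rw [mul_pow, ← pow_mul, mul_mul_mul_comm, ← mul_assoc, mul_assoc, ← mul_pow, u.mul_inv,
      one_pow, mul_one]

include hu hδu in
/-- The degree-zero ring is generated over its constants by `s ^ m / u`: in the expansion of an
element of degree zero in powers of the slice `s`, only exponents divisible by `m` occur. -/
theorem isPolynomialRingInOneVariable_degree_zero [IsDomain S] [Algebra ℚ S]
    (hP : ∀ q : ℚ, algebraMap ℚ S q ∈ P 0) (hδ : IsHomogeneousDerivation P δ e)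
    (hnilpotent : ∀ x ∈ P 0, ∃ n, δ^[n] x = 0) (hs : s ∈ P (-e)) (hδs : δ s = 1)
    (hm : m ≠ 0) (hu' : (↑u⁻¹ : S) ∈ P (m * e))
    (hconst : ∀ j : ℕ, ∀ x ∈ P (j * e), x ≠ 0 → δ x = 0 → m ∣ j) :
    IsPolynomialRingInOneVariable (SetLike.GradeZero.subring P) := by
  have : CharZero S := algebraRat.charZero S
  have ht : s ^ m * ↑u⁻¹ ∈ P 0 := by
    simpa using SetLike.GradedMul.mul_mem (SetLike.pow_mem_graded m hs) hu'
  have hδt : δ (s ^ m * ↑u⁻¹) ≠ 0 := by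
    have hδu' : δ ↑u⁻¹ = 0 := by rw [δ.leibniz_of_mul_eq_one u.inv_mul, hδu, smul_zero]
    have hs0 : s ≠ 0 := fun h => by simp [h] at hδs
    simp [Derivation.leibniz, Derivation.leibniz_pow, hδu', hδs, hm, hs0]
  let t : SetLike.GradeZero.subring P := ⟨s ^ m * ↑u⁻¹, ht⟩
  let A := (constantSubring δ).comap (SetLike.GradeZero.subring P).subtype
  suffices hsurjective : Function.Surjective (Polynomial.aeval (R := A) t) from
    ⟨A, ⟨(AlgEquiv.ofBijective _
      ⟨aeval_injective_of_apply_ne_zero _ hδt, hsurjective⟩).symm⟩⟩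
  rintro ⟨x, hx⟩
  obtain ⟨N, hN⟩ := hnilpotent x hx
  obtain ⟨c, hc, hsum⟩ := exists_eq_sum_const_mul_pow_slice hP hδ hs hδs N hx hN
  have hterm : ∀ j, ∃ p : Polynomial A, (Polynomial.aeval t p : S) = c j * s ^ j := by
    intro j
    obtain ⟨hcj, hδcj⟩ := hc j
    rw [zero_add] at hcj
    rcases eq_or_ne (c j) 0 with hcj0 | hcj0
    · exact ⟨0, by simp [hcj0]⟩
    obtain ⟨q, rfl⟩ := hconst j (c j) hcj hcj0 hδcj
    obtain ⟨a, ha, hδa, hacj⟩ :=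
      exists_degree_zero_const_mul_slice_pow_eq (s := s) hu hδu hcj hδcj
    refine ⟨Polynomial.C ⟨⟨a, ha⟩, hδa⟩ * Polynomial.X ^ q, ?_⟩
    rw [map_mul, map_pow, Polynomial.aeval_X, Polynomial.aeval_C]
    exact hacj
  choose p hp using hterm
  refine ⟨∑ j ∈ Finset.range N, p j, Subtype.ext ?_⟩
  rw [map_sum, AddSubmonoidClass.coe_finsetSum, Finset.sum_congr rfl fun j _ => hp j, ← hsum]

end GradedSlices

section HomogeneousConstants

variable {R : Type*} [CommRing R] {ℛ : ℤ → AddSubgroup R} {D : Derivation ℤ R R}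
  {e : ℤ}

theorem IsHomogeneousDerivation.exists_localSlice (hD : IsHomogeneousDerivation ℛ D e)
    (hnilpotent : IsLocallyNilpotentDerivation D) {i : ℤ} {x : R} (hx : x ∈ ℛ i) (hDx : D x ≠ 0) :
    ∃ τ, ∃ t ∈ ℛ τ, D t ≠ 0 ∧ D (D t) = 0 := by
  obtain ⟨m, hm⟩ := exists_hasNilpotencyDegree hDx ((hnilpotent (D x)).imp fun _ h => h.2)
  refine ⟨_, D^[m] x, hD.iterate_mem hx m, ?_, ?_⟩
  · rw [← Function.iterate_succ_apply' D]
    exact hm.1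
  · rw [← Function.iterate_succ_apply' D, ← Function.iterate_succ_apply' D]
    exact hm.2

variable [GradedRing ℛ]

theorem exists_homogeneous_apply_ne_zero (hD0 : D ≠ 0) : ∃ i, ∃ x ∈ ℛ i, D x ≠ 0 := by
  by_contra! h
  refine hD0 (Derivation.ext fun x => ?_)
  induction x using DirectSum.Decomposition.inductionOn ℛ with
  | zero => simp
  | homogeneous x => exact h _ _ x.2
  | add x y hx hy => rw [map_add, map_add, hx, hy]

section AwayPiece

variable {K : Type*} [Field K] [Algebra R K] {f : R} {n : ℤ} {hf : f ∈ ℛ n}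
  (hDf : D f = 0) {δ : Derivation ℤ K K}
  (hδ : Function.Semiconj (algebraMap R K) D δ)

include hDf hδ

theorem IsHomogeneousDerivation.awayPiece (hD : IsHomogeneousDerivation ℛ D e) :
    IsHomogeneousDerivation (awayPiece K hf) δ e := by
  rintro i x ⟨l, b, hb, hx⟩
  refine ⟨l, D b, ?_, ?_⟩
  · rw [show i + e + l * n = i + l * n + e by ring]
    exact hD _ _ hb
  · rw [hδ.eq b, ← hx, Derivation.leibniz, Derivation.leibniz_pow, ← hδ.eq f, hDf]
    simp [mul_comm]

theorem exists_iterate_eq_zero_of_mem_awayPiece (hf0 : algebraMap R K f ≠ 0)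
    (hnilpotent : IsLocallyNilpotentDerivation D) {i : ℤ} {x : K} (hx : x ∈ awayPiece K hf i) :
    ∃ N, δ^[N] x = 0 := by
  obtain ⟨l, b, -, hx⟩ := hx
  obtain ⟨N, -, hN⟩ := hnilpotent b
  refine ⟨N, ?_⟩
  have hδf : δ (algebraMap R K f ^ l) = 0 := by
    rw [Derivation.leibniz_pow, ← hδ.eq f, hDf, map_zero, smul_zero, smul_zero]
  have hzero : algebraMap R K f ^ l * δ^[N] x = 0 := by
    rw [← iterate_derivation_const_mul hδf, mul_comm, hx, ← (hδ.iterate_right N).eq, hN, map_zero]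
  exact (mul_eq_zero.1 hzero).resolve_left (pow_ne_zero l hf0)

end AwayPiece

variable [IsDomain R]

variable (ℛ D) in
/-- The subgroup of `ℤ` generated by the degrees of the nonzero homogeneous constants of `D`. As
these degrees form a submonoid, it consists of their differences. -/
def constantDegrees : AddSubgroup ℤ where
  carrier := {l | ∃ i, ∃ a ∈ ℛ i, ∃ j, ∃ b ∈ ℛ j, (a ≠ 0 ∧ D a = 0) ∧ (b ≠ 0 ∧ D b = 0) ∧
    l = i - j}
  zero_mem' := ⟨0, 1, SetLike.GradedOne.one_mem, 0, 1, SetLike.GradedOne.one_mem,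
    ⟨one_ne_zero, D.map_one_eq_zero⟩, ⟨one_ne_zero, D.map_one_eq_zero⟩, (sub_self 0).symm⟩
  add_mem' := by
    rintro _ _ ⟨i, a, ha, j, b, hb, ⟨ha0, hDa⟩, ⟨hb0, hDb⟩, rfl⟩
      ⟨i', a', ha', j', b', hb', ⟨ha0', hDa'⟩, ⟨hb0', hDb'⟩, rfl⟩
    exact ⟨i + i', a * a', SetLike.GradedMul.mul_mem ha ha', j + j', b * b',
      SetLike.GradedMul.mul_mem hb hb',
      ⟨mul_ne_zero ha0 ha0', mul_mem (S := Subring R) (s := constantSubring D) hDa hDa'⟩,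
      ⟨mul_ne_zero hb0 hb0', mul_mem (S := Subring R) (s := constantSubring D) hDb hDb'⟩,
      (add_sub_add_comm _ _ _ _).symm⟩
  neg_mem' := by
    rintro _ ⟨i, a, ha, j, b, hb, ha', hb', rfl⟩
    exact ⟨j, b, hb, i, a, ha, hb', ha', neg_sub i j⟩

theorem degree_mem_constantDegrees {i : ℤ} {a : R} (ha : a ∈ ℛ i) (ha0 : a ≠ 0)
    (hDa : D a = 0) : i ∈ constantDegrees ℛ D :=
  ⟨i, a, ha, 0, 1, SetLike.GradedOne.one_mem, ⟨ha0, hDa⟩, ⟨one_ne_zero, D.map_one_eq_zero⟩,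
    (sub_zero i).symm⟩

theorem exists_period_constantDegrees (e : ℤ) {n : ℤ} (hn : n ≠ 0)
    (hmem : n ∈ constantDegrees ℛ D) :
    ∃ m : ℕ, m ≠ 0 ∧ (m : ℤ) * e ∈ constantDegrees ℛ D ∧
      ∀ j : ℕ, (j : ℤ) * e ∈ constantDegrees ℛ D → m ∣ j := by
  obtain ⟨g, hg⟩ := Int.subgroup_cyclic ((constantDegrees ℛ D).comap (AddMonoidHom.mulRight e))
  have hmem_iff : ∀ j : ℤ, j * e ∈ constantDegrees ℛ D ↔ g ∣ j := by
    intro j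
    rw [← Int.mem_zmultiples_iff, AddSubgroup.zmultiples_eq_closure, ← hg]
    rfl
  refine ⟨g.natAbs, ?_, (hmem_iff _).2 Int.dvd_natAbs_self, fun j hj =>
    Int.natAbs_dvd_natAbs.2 ((hmem_iff j).1 hj)⟩
  have hne : n * e ∈ constantDegrees ℛ D := by
    simpa [mul_comm] using zsmul_mem hmem e
  rw [Int.natAbs_ne_zero]
  rintro rfl
  exact hn (zero_dvd_iff.1 ((hmem_iff n).1 hne))

theorem degree_mem_constantDegrees_of_mem_awayPiece {K : Type*} [Field K] [Algebra R K]
    [FaithfulSMul R K] {δ : Derivation ℤ K K} (hδ : Function.Semiconj (algebraMap R K) D δ)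
    {f : R} {n : ℤ} {hf : f ∈ ℛ n} (hf0 : f ≠ 0) (hDf : D f = 0) {i : ℤ} {x : K}
    (hx : x ∈ awayPiece K hf i) (hx0 : x ≠ 0) (hδx : δ x = 0) : i ∈ constantDegrees ℛ D := by
  obtain ⟨l, b, hb, hx⟩ := hx
  have hinj := FaithfulSMul.algebraMap_injective R K
  have hb0 : b ≠ 0 := by
    rintro rfl
    rw [map_zero] at hx
    exact mul_ne_zero hx0 (pow_ne_zero l ((map_ne_zero_iff _ hinj).2 hf0)) hx
  have hDb : D b = 0 := hinj <| by
    rw [hδ.eq b, ← hx, Derivation.leibniz, Derivation.leibniz_pow, ← hδ.eq f, hDf, hδx]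
    simp
  simpa using sub_mem (degree_mem_constantDegrees hb hb0 hDb)
    (zsmul_mem (degree_mem_constantDegrees hf hf0 hDf) l)

theorem exists_const_degree_ne_zero_of_dvd {g p : R} {n i : ℤ} (hn : n ≠ 0) (hg : g ∈ ℛ n)
    (hg0 : g ≠ 0) (hDg : D g = 0) (hp : p ∈ ℛ i) (hp0 : p ≠ 0) (hDp : D p = 0) :
    ∃ j, j ≠ 0 ∧ ∃ f ∈ ℛ j, f ≠ 0 ∧ D f = 0 ∧ p ∣ f := by
  rcases eq_or_ne i 0 with rfl | hi
  · refine ⟨n, hn, p * g, ?_, mul_ne_zero hp0 hg0, ?_, dvd_mul_right p g⟩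
    · simpa using SetLike.GradedMul.mul_mem hp hg
    · rw [Derivation.leibniz, hDg, hDp, smul_zero, smul_zero, add_zero]
  · exact ⟨i, hi, p, hp, hp0, hDp, dvd_rfl⟩

theorem exists_semiconj_derivation_of_isAlgebraic [CharZero R] {K : Type*} [Field K] [Algebra R K]
    [FaithfulSMul R K] [Algebra.IsAlgebraic R K] (D : Derivation ℤ R R) :
    ∃ δ : Derivation ℤ K K, Function.Semiconj (algebraMap R K) D δ := by
  have : CharZero K := charZero_of_injective_algebraMap (FaithfulSMul.algebraMap_injective R K)
  obtain ⟨δ, hδ⟩ :=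
    exists_derivation_extending_of_isAlgebraic ((Algebra.linearMap R K).compDer D)
  exact ⟨δ, fun r => (hδ r).symm⟩

theorem isCylindrical_of_slice [Algebra ℚ R] {K : Type*} [Field K] [Algebra R K]
    [FaithfulSMul R K] {δ : Derivation ℤ K K} (hδ : Function.Semiconj (algebraMap R K) D δ)
    (hD : IsHomogeneousDerivation ℛ D e) (hnilpotent : IsLocallyNilpotentDerivation D)
    {f : R} {n : ℤ} (hn : n ≠ 0) (hf : f ∈ ℛ n) (hf0 : f ≠ 0) (hDf : D f = 0)
    {s : K} (hs : s ∈ awayPiece K hf (-e)) (hδs : δ s = 1) {m : ℕ} (hm : m ≠ 0)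
    (hconst : ∀ j : ℕ, (j : ℤ) * e ∈ constantDegrees ℛ D → m ∣ j) {u : Kˣ}
    (hu : (u : K) ∈ awayPiece K hf (-(m * e))) (hu' : (↑u⁻¹ : K) ∈ awayPiece K hf (m * e))
    (hδu : δ u = 0) : IsCylindrical ℛ f := by
  have hf0' : algebraMap R K f ≠ 0 :=
    (map_ne_zero_iff _ (FaithfulSMul.algebraMap_injective R K)).2 hf0
  let _ : Algebra ℚ K := Algebra.compHom K (algebraMap ℚ R)
  refine ⟨hf0, ⟨n, hn, hf⟩, (isPolynomialRingInOneVariable_away_iff K hf hf0).2 ?_⟩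
  exact isPolynomialRingInOneVariable_degree_zero hu hδu
    (fun q => algebraMap_mem_awayPiece hf (algebraMap_mem_degree_zero q)) (hD.awayPiece hDf hδ)
    (fun x hx => exists_iterate_eq_zero_of_mem_awayPiece hDf hδ hf0' hnilpotent hx) hs hδs hm hu'
    fun j x hx hx0 hδx => hconst j
      (degree_mem_constantDegrees_of_mem_awayPiece hδ hf0 hDf hx hx0 hδx)

theorem exists_isCylindrical_of_const [Algebra ℚ R] (hD : IsHomogeneousDerivation ℛ D e)
    (hnilpotent : IsLocallyNilpotentDerivation D) (hD0 : D ≠ 0) {n : ℤ} {g : R} (hn : n ≠ 0)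
    (hg : g ∈ ℛ n) (hg0 : g ≠ 0) (hDg : D g = 0) : ∃ f, IsCylindrical ℛ f := by
  -- `FractionRing R` itself carries two `ℤ`-algebra structures that are not syntactically equal.
  obtain ⟨K, _, _, _⟩ : ∃ (K : Type _) (_ : Field K) (_ : Algebra R K), IsFractionRing R K :=
    ⟨FractionRing R, inferInstance, inferInstance, inferInstance⟩
  have : Algebra.IsAlgebraic R K := IsLocalization.isAlgebraic K (nonZeroDivisors R)
  have hι : ∀ {x : R}, x ≠ 0 → algebraMap R K x ≠ 0 :=
    (map_ne_zero_iff _ (FaithfulSMul.algebraMap_injective R K)).2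
  obtain ⟨i, x, hx, hDx⟩ := exists_homogeneous_apply_ne_zero (ℛ := ℛ) hD0
  obtain ⟨τ, t, ht, hDt, hDDt⟩ := hD.exists_localSlice hnilpotent hx hDx
  obtain ⟨m, hm, ⟨i, a, ha, j, b, hb, ⟨ha0, hDa⟩, ⟨hb0, hDb⟩, hij⟩, hconst⟩ :=
    exists_period_constantDegrees e hn (degree_mem_constantDegrees hg hg0 hDg)
  have hDp : D (D t * a * b) = 0 :=
    mul_mem (S := Subring R) (s := constantSubring D) (mul_mem hDDt hDa) hDb
  obtain ⟨l, hl, f, hf, hf0, hDf, hdvd⟩ := exists_const_degree_ne_zero_of_dvd hn hg hg0 hDg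
    (SetLike.GradedMul.mul_mem (SetLike.GradedMul.mul_mem (hD τ t ht) ha) hb)
    (mul_ne_zero (mul_ne_zero hDt ha0) hb0) hDp
  have : CharZero R := algebraRat.charZero R
  obtain ⟨δ, hδ⟩ := exists_semiconj_derivation_of_isAlgebraic (K := K) D
  have hs : algebraMap R K t / algebraMap R K (D t) ∈ awayPiece K hf (-e) := by
    simpa using div_mem_awayPiece (K := K) hf hf0 ht (hD τ t ht)
      (((dvd_mul_right _ _).mul_right b).trans hdvd)
  have hu : algebraMap R K b / algebraMap R K a ∈ awayPiece K hf (-(m * e)) := by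
    simpa [hij] using div_mem_awayPiece (K := K) hf hf0 hb ha
      (((dvd_mul_left a _).mul_right b).trans hdvd)
  have hu' : algebraMap R K a / algebraMap R K b ∈ awayPiece K hf (m * e) := by
    simpa [hij] using div_mem_awayPiece (K := K) hf hf0 ha hb ((dvd_mul_left b _).trans hdvd)
  refine ⟨f, isCylindrical_of_slice hδ hD hnilpotent hl hf hf0 hDf hs ?_ hm hconst
    (u := Units.mk0 _ (div_ne_zero (hι hb0) (hι ha0))) hu ?_ ?_⟩
  · rw [Derivation.leibniz_div_const _ _ _ (by rw [← hδ.eq, hDDt, map_zero]), ← hδ.eq,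
      smul_eq_mul, inv_mul_cancel₀ (hι hDt)]
  · rwa [Units.val_inv_eq_inv_val, Units.val_mk0, inv_div]
  · rw [Units.val_mk0, Derivation.leibniz_div_const _ _ _ (by rw [← hδ.eq, hDa, map_zero]),
      ← hδ.eq, hDb, map_zero, smul_zero]

end HomogeneousConstants

section ConstantsOfNonzeroDegree

variable {R : Type*} [CommRing R] {ℛ : ℤ → AddSubgroup R} {D : Derivation ℤ R R}
  {e : ℤ}

theorem IsHomogeneousDerivation.exists_const_mem (hD : IsHomogeneousDerivation ℛ D e)
    (hnilpotent : IsLocallyNilpotentDerivation D) {i : ℤ} {x : R} (hx : x ∈ ℛ i) (hx0 : x ≠ 0) :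
    ∃ n : ℕ, ∃ a ∈ ℛ (i + n * e), a ≠ 0 ∧ D a = 0 := by
  obtain ⟨n, hn⟩ := exists_hasNilpotencyDegree hx0 ((hnilpotent x).imp fun _ h => h.2)
  exact ⟨n, D^[n] x, hD.iterate_mem hx n, hn.1,
    (Function.iterate_succ_apply' D n x).symm.trans hn.2⟩

theorem IsHomogeneousDerivation.exists_const_degree_ne_zero_of_neg_of_pos
    (hD : IsHomogeneousDerivation ℛ D e) (hnilpotent : IsLocallyNilpotentDerivation D)
    {i j : ℤ} (hi : i < 0) (hj : 0 < j) {x y : R} (hx : x ∈ ℛ i) (hx0 : x ≠ 0) (hy : y ∈ ℛ j)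
    (hy0 : y ≠ 0) : ∃ n ≠ 0, ∃ a ∈ ℛ n, a ≠ 0 ∧ D a = 0 := by
  obtain ⟨m, a, ha, ha'⟩ := hD.exists_const_mem hnilpotent hx hx0
  obtain ⟨n, b, hb, hb'⟩ := hD.exists_const_mem hnilpotent hy hy0
  by_cases h : i + m * e = 0
  · refine ⟨j + n * e, fun h' => ?_, b, hb, hb'⟩
    rcases le_total e 0 with he | he <;> nlinarith
  · exact ⟨_, h, a, ha, ha'⟩

theorem iterate_sub_localSlice_pow_eq_zero {t : R} (hDDt : D (D t) = 0) {N : ℕ} {x : R}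
    (hx : D (D^[N] x) = 0) :
    D^[N] (N.factorial * D t ^ N * x - D^[N] x * t ^ N) = 0 := by
  have hconst : D (N.factorial * D t ^ N) = 0 := by
    simp [Derivation.leibniz, Derivation.leibniz_pow, hDDt]
  rw [iterate_map_sub, iterate_derivation_const_mul hconst, iterate_derivation_const_mul hx,
    iterate_pow_localSlice hDDt, mul_comm, sub_self]

variable [IsDomain R] [GradedRing ℛ] {A : Type*} [CommRing A] [Algebra A R]

/-- Subtracting a suitable multiple of `t ^ N` from a multiple of `x` lowers the nilpotency degree
of `x`; the coefficients are constants, hence of degree zero. -/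
theorem isAlgebraic_of_constants_degree_zero [CharZero R] (hD : IsHomogeneousDerivation ℛ D e)
    (hA : ∀ a ∈ ℛ 0, a ∈ (algebraMap A R).range)
    (hconst : ∀ n, ∀ a ∈ ℛ n, a ≠ 0 → D a = 0 → n = 0) {t : R} (ht : t ∈ ℛ (-e))
    (hDt : D t ≠ 0) (hDDt : D (D t) = 0) (N : ℕ) {i : ℤ} {x : R} (hx : x ∈ ℛ i)
    (hxN : D^[N] x = 0) : IsAlgebraic (Algebra.adjoin A {t}) x := by
  have hdegree_zero : ∀ {a : R}, a ∈ ℛ 0 → a ∈ Algebra.adjoin A {t} := by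
    intro a ha
    obtain ⟨c, rfl⟩ := hA a ha
    exact algebraMap_mem _ c
  have hDt0 : D t ∈ SetLike.GradeZero.subring ℛ := by
    change D t ∈ ℛ 0
    simpa using hD _ t ht
  induction N generalizing x with
  | zero =>
    obtain rfl : x = 0 := hxN
    exact isAlgebraic_zero
  | succ N ih =>
    rcases eq_or_ne (D^[N] x) 0 with hc0 | hc0
    · exact ih hx hc0
    have hDc : D (D^[N] x) = 0 := (Function.iterate_succ_apply' D N x).symm.trans hxN
    have hi : i + N * e = 0 := hconst _ _ (hD.iterate_mem hx N) hc0 hDc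
    have hc : D^[N] x ∈ ℛ 0 := hi ▸ hD.iterate_mem hx N
    let b : R := N.factorial * D t ^ N
    have hb : b ∈ SetLike.GradeZero.subring ℛ := mul_mem (natCast_mem _ _) (pow_mem hDt0 N)
    have hb0 : b ≠ 0 := mul_ne_zero (Nat.cast_ne_zero.2 N.factorial_ne_zero) (pow_ne_zero N hDt)
    have hbx : b * x ∈ ℛ i := by simpa using SetLike.GradedMul.mul_mem hb hx
    have hct : D^[N] x * t ^ N ∈ ℛ i := by
      convert SetLike.GradedMul.mul_mem hc (SetLike.pow_mem_graded N ht) using 2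
      rw [nsmul_eq_mul]
      linarith
    have hremainder : IsAlgebraic (Algebra.adjoin A {t}) (b * x - D^[N] x * t ^ N) :=
      ih (sub_mem hbx hct) (iterate_sub_localSlice_pow_eq_zero hDDt hDc)
    have hleading : IsAlgebraic (Algebra.adjoin A {t}) (D^[N] x * t ^ N) :=
      isAlgebraic_algebraMap (⟨_, mul_mem (hdegree_zero hc)
        (pow_mem (Algebra.self_mem_adjoin_singleton A t) N)⟩ : Algebra.adjoin A {t})
    refine .of_mul (mem_nonZeroDivisors_of_ne_zero hb0)
      (isAlgebraic_algebraMap (⟨b, hdegree_zero hb⟩ : Algebra.adjoin A {t})) ?_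
    simpa only [sub_add_cancel, mul_comm] using hremainder.add hleading

theorem IsHomogeneousDerivation.exists_const_degree_ne_zero_of_two_le_trdeg [CharZero R]
    (hD : IsHomogeneousDerivation ℛ D e) (hnilpotent : IsLocallyNilpotentDerivation D)
    (hD0 : D ≠ 0) (hA : ∀ a ∈ ℛ 0, a ∈ (algebraMap A R).range) (htrdeg : 2 ≤ Algebra.trdeg A R) :
    ∃ n ≠ 0, ∃ a ∈ ℛ n, a ≠ 0 ∧ D a = 0 := by
  by_contra! hconst
  replace hconst : ∀ n, ∀ a ∈ ℛ n, a ≠ 0 → D a = 0 → n = 0 :=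
    fun n a ha ha0 hDa => by_contra fun hn => hconst n hn a ha ha0 hDa
  obtain ⟨i, x, hx, hDx⟩ := exists_homogeneous_apply_ne_zero (ℛ := ℛ) hD0
  obtain ⟨τ, t, ht, hDt, hDDt⟩ := hD.exists_localSlice hnilpotent hx hDx
  obtain rfl : τ = -e := eq_neg_of_add_eq_zero_left (hconst _ _ (hD τ t ht) hDt hDDt)
  have halg : Algebra.IsAlgebraic (Algebra.adjoin A {t}) R := by
    refine ⟨fun x => ?_⟩
    induction x using DirectSum.Decomposition.inductionOn ℛ with
    | zero => exact isAlgebraic_zero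
    | @homogeneous i x =>
      obtain ⟨N, -, hN⟩ := hnilpotent (x : R)
      exact isAlgebraic_of_constants_degree_zero hD hA hconst ht hDt hDDt N x.2 hN
    | add x y hx hy => exact hx.add hy
  have hle := htrdeg.trans (Algebra.IsAlgebraic.trdeg_le_cardinalMk A {t})
  rw [Cardinal.mk_singleton] at hle
  exact absurd hle (by norm_num)

end ConstantsOfNonzeroDegree

section CylindricalOfNonRigid

variable {B : Type*} [CommRing B] [IsDomain B] (𝒜 : ℤ → AddSubgroup B) [GradedRing 𝒜]

theorem exists_mem_veroneseGrading_ne_zero {i : ℤ} (hi : 𝒜 i ≠ ⊥) (d : ℕ) :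
    ∃ x ∈ veroneseGrading 𝒜 d i, x ≠ 0 := by
  obtain ⟨x, hx, hx0⟩ := (𝒜 i).bot_or_exists_ne_zero.resolve_left hi
  refine ⟨⟨x ^ d, pow_mem_veroneseSubring 𝒜 hx⟩, ?_, fun h =>
    pow_ne_zero d hx0 (congrArg Subtype.val h)⟩
  simpa only [mem_veroneseGrading, nsmul_eq_mul] using SetLike.pow_mem_graded d hx

/-- The degree-zero subring of `B` acts on every Veronese subring, which contains it. -/
abbrev veroneseDegreeZeroAlgebra (d : ℤ) :
    Algebra (SetLike.GradeZero.subring 𝒜) (veroneseSubring 𝒜 d) :=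
  (Subring.inclusion (S := SetLike.GradeZero.subring 𝒜) (T := veroneseSubring 𝒜 d)
    fun _ ha => mem_veroneseSubring_of_dvd 𝒜 (dvd_zero d) ha).toAlgebra

theorem trdeg_veroneseSubring {d : ℕ} (hd : 1 ≤ d) :
    letI := veroneseDegreeZeroAlgebra 𝒜 d
    Algebra.trdeg (SetLike.GradeZero.subring 𝒜) (veroneseSubring 𝒜 d) =
      Algebra.trdeg (SetLike.GradeZero.subring 𝒜) B := by
  let _ := veroneseDegreeZeroAlgebra 𝒜 d
  have : IsScalarTower (SetLike.GradeZero.subring 𝒜) (veroneseSubring 𝒜 d) B :=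
    IsScalarTower.of_algebraMap_eq fun _ => rfl
  have : FaithfulSMul (SetLike.GradeZero.subring 𝒜) (veroneseSubring 𝒜 d) :=
    (faithfulSMul_iff_algebraMap_injective _ _).2 (Subring.inclusion_injective _)
  have := veroneseSubring_isIntegral 𝒜 hd
  rw [← trdeg_add_eq (SetLike.GradeZero.subring 𝒜) (veroneseSubring 𝒜 d) (A := B),
    trdeg_eq_zero (R := veroneseSubring 𝒜 d), add_zero]

theorem exists_isCylindrical_of_not_isRigidRing (k : Type*) [Field k] [CharZero k] [Algebra k B]
    [Algebra.FiniteType k B]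
    (hB : 2 ≤ Algebra.trdeg (SetLike.GradeZero.subring 𝒜) B ∨
      ∃ i j : ℤ, i < 0 ∧ 0 < j ∧ 𝒜 i ≠ ⊥ ∧ 𝒜 j ≠ ⊥)
    {d : ℕ} (hd : 1 ≤ d) (hrigid : ¬ IsRigidRing (veroneseSubring 𝒜 d)) :
    ∃ f, IsCylindrical 𝒜 f := by
  have : NeZero (d : ℤ) := ⟨by positivity⟩
  let _ := veroneseAlgebra 𝒜 k d
  have := veroneseSubring_finiteType 𝒜 k hd
  let _ : Algebra ℚ (veroneseSubring 𝒜 d) := Algebra.compHom _ (algebraMap ℚ k)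
  have : CharZero (veroneseSubring 𝒜 d) := algebraRat.charZero _
  obtain ⟨D₀, hD₀, hD₀0⟩ : ∃ D : Derivation ℤ (veroneseSubring 𝒜 d) (veroneseSubring 𝒜 d),
    IsLocallyNilpotentDerivation D ∧ D ≠ 0 := by simpa [IsRigidRing] using hrigid
  obtain ⟨e, D, hD0, hnilpotent, hD⟩ :=
    hD₀.exists_homogeneous (veroneseGrading 𝒜 d) (k := k) hD₀0
  obtain ⟨n, hn, g, hg, hg0, hDg⟩ : ∃ n ≠ 0, ∃ g ∈ veroneseGrading 𝒜 d n, g ≠ 0 ∧ D g = 0 := by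
    rcases hB with htrdeg | ⟨i, j, hi, hj, hBi, hBj⟩
    · let _ := veroneseDegreeZeroAlgebra 𝒜 d
      refine hD.exists_const_degree_ne_zero_of_two_le_trdeg hnilpotent hD0
        (A := SetLike.GradeZero.subring 𝒜) (fun a ha => ?_)
        (htrdeg.trans_eq (trdeg_veroneseSubring 𝒜 hd).symm)
      rw [mem_veroneseGrading, mul_zero] at ha
      exact ⟨⟨a, ha⟩, rfl⟩
    · obtain ⟨x, hx, hx0⟩ := exists_mem_veroneseGrading_ne_zero 𝒜 hBi d
      obtain ⟨y, hy, hy0⟩ := exists_mem_veroneseGrading_ne_zero 𝒜 hBj d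
      exact hD.exists_const_degree_ne_zero_of_neg_of_pos hnilpotent hi hj hx hx0 hy hy0
  obtain ⟨f, hf⟩ := exists_isCylindrical_of_const hD hnilpotent hD0 hn hg hg0 hDg
  exact ⟨f, hf.of_veronese⟩

end CylindricalOfNonRigid

section CylinderDerivation

theorem exists_derivation_extending_of_transcendental {P K : Type*} [CommRing P] [IsDomain P]
    [Field K] [CharZero K] [Algebra P K] {t : K} (ht : Transcendental P t)
    (halg : Algebra.IsAlgebraic (Algebra.adjoin P {t}) K) (D : Derivation ℤ P P) :
    ∃ δ : Derivation ℤ K K, δ t = 0 ∧ Function.Semiconj (algebraMap P K) D δ := by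
  let _ : Differential P := ⟨D⟩
  let coeffwise : Derivation ℤ (Polynomial P) (Polynomial P) := Differential.mapCoeffs
  have hcoeffwise_C : ∀ p, coeffwise (Polynomial.C p) = Polynomial.C (D p) :=
    Differential.mapCoeffs_C
  have hcoeffwise_X : coeffwise Polynomial.X = 0 := Differential.mapCoeffs_X
  let _ : Algebra (Polynomial P) K := (Polynomial.aeval t).toRingHom.toAlgebra
  have : FaithfulSMul (Polynomial P) K :=
    (faithfulSMul_iff_algebraMap_injective _ _).2 (transcendental_iff_injective.1 ht)
  have : Algebra.IsAlgebraic (Polynomial P) K := by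
    refine .of_ringHom_of_comp_eq ((Polynomial.aeval t).codRestrict (Algebra.adjoin P {t}) fun _ =>
      Polynomial.aeval_mem_adjoin_singleton P t) (RingHom.id K) ?_ Function.injective_id rfl
    rintro ⟨x, hx⟩
    obtain ⟨q, rfl⟩ := Algebra.adjoin_singleton_eq_range_aeval P t ▸ hx
    exact ⟨q, rfl⟩
  obtain ⟨δ, hδ⟩ := exists_derivation_extending_of_isAlgebraic
    ((Algebra.linearMap (Polynomial P) K).compDer coeffwise)
  have hδ' : ∀ q, δ (Polynomial.aeval t q) = Polynomial.aeval t (coeffwise q) := hδ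
  refine ⟨δ, ?_, fun p => ?_⟩
  · simpa [hcoeffwise_X] using hδ' Polynomial.X
  · simpa [hcoeffwise_C] using (hδ' (Polynomial.C p)).symm

theorem iterate_zpow_mul_of_semiconj {K : Type*} [Field K] {P : Subring K} {D : Derivation ℤ P P}
    {δ : Derivation ℤ K K} (hDδ : Function.Semiconj (algebraMap P K) D δ) {t : K} (ht : δ t = 0)
    (j : ℤ) (m : ℕ) (p : P) : δ^[m] (t ^ j * p) = t ^ j * (D^[m] p : P) := by
  rw [iterate_derivation_const_mul (by rw [δ.leibniz_zpow, ht, smul_zero, smul_zero])]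
  exact congrArg _ ((hDδ.iterate_right m).eq p).symm

theorem exists_pow_mul_derivation_mem_range {k R S : Type*} [CommRing k] [CommRing R] [CommRing S]
    [Algebra k R] [Algebra.FiniteType k R] [Algebra R S] {δ : Derivation ℤ S S} {f : R}
    (hk : ∀ c : k, δ (algebraMap R S (algebraMap k R c)) = 0)
    (hδ : ∀ r, ∃ N : ℕ, algebraMap R S f ^ N * δ (algebraMap R S r) ∈ (algebraMap R S).range) :
    ∃ N : ℕ, ∀ r, algebraMap R S f ^ N * δ (algebraMap R S r) ∈ (algebraMap R S).range := by
  obtain ⟨s, hs⟩ := ‹Algebra.FiniteType k R›.out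
  choose N hN using hδ
  refine ⟨s.sup N, fun r => ?_⟩
  have hr : r ∈ Algebra.adjoin k (s : Set R) := hs ▸ Algebra.mem_top
  induction hr using Algebra.adjoin_induction with
  | mem x hx =>
    rw [← Nat.sub_add_cancel (Finset.le_sup (f := N) hx), pow_add, mul_assoc, ← map_pow]
    exact mul_mem ⟨_, rfl⟩ (hN x)
  | algebraMap c => exact ⟨0, by rw [hk, mul_zero, map_zero]⟩
  | add x y _ _ hx hy =>
    rw [map_add, map_add, mul_add]
    exact add_mem hx hy
  | mul x y _ _ hx hy =>
    rw [map_mul, Derivation.leibniz, smul_eq_mul, smul_eq_mul, mul_add, mul_left_comm,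
      mul_left_comm (_ ^ _)]
    exact add_mem (mul_mem ⟨x, rfl⟩ hy) (mul_mem ⟨y, rfl⟩ hx)

variable {R K : Type*} [CommRing R] [Field K] [Algebra R K] {ℛ : ℤ → AddSubgroup R} {f : R}
  {n : ℤ}

theorem algebraMap_zpow_mem_awayPiece [SetLike.GradedMonoid ℛ] (hf : f ∈ ℛ n)
    (hf0 : algebraMap R K f ≠ 0) (j : ℤ) : algebraMap R K f ^ j ∈ awayPiece K hf (j * n) := by
  obtain ⟨m, rfl | rfl⟩ := j.eq_nat_or_neg
  · rw [zpow_natCast, ← map_pow]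
    exact algebraMap_mem_awayPiece hf (by simpa using SetLike.pow_mem_graded m hf)
  · refine ⟨m, 1, ?_, ?_⟩
    · simpa using SetLike.GradedOne.one_mem (A := ℛ)
    · rw [zpow_neg, zpow_natCast, inv_mul_cancel₀ (pow_ne_zero m hf0), map_one]

theorem exists_eq_zpow_mul_of_mem_awayPiece [SetLike.GradedMonoid ℛ] (hf : f ∈ ℛ n)
    (hf0 : algebraMap R K f ≠ 0) (hn : IsUnit n) {i : ℤ} {x : K} (hx : x ∈ awayPiece K hf i) :
    ∃ p ∈ SetLike.GradeZero.subring (awayPiece K hf), x = algebraMap R K f ^ (i * n) * p := by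
  refine ⟨algebraMap R K f ^ (-(i * n)) * x, ?_, ?_⟩
  · have hmem := SetLike.GradedMul.mul_mem (algebraMap_zpow_mem_awayPiece hf hf0 (-(i * n))) hx
    rwa [neg_mul, mul_assoc, Int.isUnit_mul_self hn, mul_one, neg_add_cancel] at hmem
  · rw [← mul_assoc, ← zpow_add₀ hf0, add_neg_cancel, zpow_zero, one_mul]

variable [GradedRing ℛ] {hf : f ∈ ℛ n}

theorem eq_zero_of_sum_awayPiece_eq_zero [FaithfulSMul R K] (hf0 : algebraMap R K f ≠ 0)
    {κ : Type*} {g : κ → ℤ} (hg : Function.Injective g) {s : Finset κ} {x : κ → K}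
    (hx : ∀ i ∈ s, x i ∈ awayPiece K hf (g i)) (hsum : ∑ i ∈ s, x i = 0) :
    ∀ i ∈ s, x i = 0 := by
  have hcommon : ∃ L : ℕ, ∀ i ∈ s, ∃ b ∈ ℛ (g i + L * n),
      x i * algebraMap R K f ^ L = algebraMap R K b := by
    choose! l b hb hlb using hx
    refine ⟨s.sup l, fun i hi => ⟨b i * f ^ (s.sup l - l i), ?_, ?_⟩⟩
    · convert SetLike.GradedMul.mul_mem (hb i hi) (SetLike.pow_mem_graded (s.sup l - l i) hf)
        using 2
      rw [nsmul_eq_mul, Nat.cast_sub (Finset.le_sup hi)]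
      ring
    · rw [map_mul, ← hlb i hi, map_pow, mul_assoc, ← pow_add,
        Nat.add_sub_cancel' (Finset.le_sup hi)]
  obtain ⟨L, hL⟩ := hcommon
  choose! b hb hLb using hL
  have hb_sum : ∑ i ∈ s, b i = 0 := FaithfulSMul.algebraMap_injective R K <| by
    rw [map_sum, ← Finset.sum_congr rfl hLb, ← Finset.sum_mul, hsum, zero_mul, map_zero]
  intro i hi
  have hbi := eq_zero_of_sum_homogeneous_eq_zero ℛ (g := fun i => g i + L * n)
    (fun i j hij => hg (add_right_cancel hij)) hb hb_sum i hi
  have hxi := hLb i hi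
  rw [hbi, map_zero] at hxi
  exact (mul_eq_zero.1 hxi).resolve_right (pow_ne_zero L hf0)

theorem transcendental_of_degree_ne_zero [FaithfulSMul R K] (hf0 : algebraMap R K f ≠ 0)
    (hn : n ≠ 0) :
    Transcendental (SetLike.GradeZero.subring (awayPiece K hf)) (algebraMap R K f) := by
  rintro ⟨p, hp0, hp⟩
  refine hp0 (Polynomial.support_eq_empty.1 (Finset.eq_empty_of_forall_notMem fun i hi => ?_))
  rw [Polynomial.aeval_def, Polynomial.eval₂_eq_sum, Polynomial.sum] at hp
  have hterm : ∀ i ∈ p.support,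
      (p.coeff i : K) * algebraMap R K f ^ i ∈ awayPiece K hf (i * n) := by
    intro i _
    simpa using SetLike.GradedMul.mul_mem (p.coeff i).2
      (algebraMap_zpow_mem_awayPiece hf hf0 i)
  have hzero := eq_zero_of_sum_awayPiece_eq_zero hf0 (g := fun i : ℕ => i * n)
    (fun i j hij => by simpa [hn] using hij) hterm hp i hi
  exact Polynomial.mem_support_iff.1 hi (Subtype.ext
    ((mul_eq_zero.1 hzero).resolve_right (pow_ne_zero i hf0)))

theorem isAlgebraic_adjoin_degree_zero [IsFractionRing R K] (hf0 : algebraMap R K f ≠ 0)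
    (hn : IsUnit n) : Algebra.IsAlgebraic
      (Algebra.adjoin (SetLike.GradeZero.subring (awayPiece K hf)) {algebraMap R K f}) K := by
  let S := Algebra.adjoin (SetLike.GradeZero.subring (awayPiece K hf)) {algebraMap R K f}
  have hmem : ∀ {x}, x ∈ S → IsAlgebraic S x := fun {x} hx =>
    isAlgebraic_algebraMap (⟨x, hx⟩ : S)
  have hzpow : ∀ j : ℤ, IsAlgebraic S (algebraMap R K f ^ j) := by
    intro j
    have halg := hmem (Algebra.self_mem_adjoin_singleton _ _)
    obtain ⟨m, rfl | rfl⟩ := j.eq_nat_or_neg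
    · simpa using halg.pow m
    · simpa using (halg.pow m).inv
  have hR : ∀ b : R, IsAlgebraic S (algebraMap R K b) := by
    intro b
    induction b using DirectSum.Decomposition.inductionOn ℛ with
    | zero => simpa using isAlgebraic_zero
    | add x y hx hy => simpa using hx.add hy
    | homogeneous b =>
      obtain ⟨p, hp, hbp⟩ := exists_eq_zpow_mul_of_mem_awayPiece hf hf0 hn
        (algebraMap_mem_awayPiece (K := K) hf b.2)
      rw [hbp]
      exact (hzpow _).mul (hmem (S.algebraMap_mem ⟨p, hp⟩))
  refine ⟨fun x => ?_⟩
  obtain ⟨b, c, -, rfl⟩ := IsFractionRing.div_surjective (A := R) x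
  rw [div_eq_mul_inv]
  exact (hR b).mul (hR c).inv

section Extension

variable {D : Derivation ℤ (SetLike.GradeZero.subring (awayPiece K hf))
  (SetLike.GradeZero.subring (awayPiece K hf))} {δ : Derivation ℤ K K}

theorem derivation_mem_awayPiece (hf0 : algebraMap R K f ≠ 0) (hn : IsUnit n)
    (hδf : δ (algebraMap R K f) = 0) (hDδ : Function.Semiconj (algebraMap _ K) D δ) {i : ℤ} {x : K}
    (hx : x ∈ awayPiece K hf i) : δ x ∈ awayPiece K hf i := by
  obtain ⟨p, hp, rfl⟩ := exists_eq_zpow_mul_of_mem_awayPiece hf hf0 hn hx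
  have hmem := SetLike.GradedMul.mul_mem (algebraMap_zpow_mem_awayPiece hf hf0 (i * n))
    (D ⟨p, hp⟩).2
  rw [add_zero, mul_assoc, Int.isUnit_mul_self hn, mul_one] at hmem
  have hδ : δ _ = _ := iterate_zpow_mul_of_semiconj hDδ hδf (i * n) 1 ⟨p, hp⟩
  exact hδ.symm ▸ hmem

theorem exists_iterate_eq_zero_of_semiconj_degree_zero (hf0 : algebraMap R K f ≠ 0) (hn : IsUnit n)
    (hD : IsLocallyNilpotentDerivation D) (hδf : δ (algebraMap R K f) = 0)
    (hDδ : Function.Semiconj (algebraMap _ K) D δ) {i : ℤ} {x : K} (hx : x ∈ awayPiece K hf i) :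
    ∃ m, δ^[m] x = 0 := by
  obtain ⟨p, hp, rfl⟩ := exists_eq_zpow_mul_of_mem_awayPiece hf hf0 hn hx
  obtain ⟨m, -, hm⟩ := hD ⟨p, hp⟩
  refine ⟨m, (iterate_zpow_mul_of_semiconj hDδ hδf (i * n) m ⟨p, hp⟩).trans ?_⟩
  rw [hm, ZeroMemClass.coe_zero, mul_zero]

theorem exists_pow_mul_derivation_mem_range_of_semiconj [IsDomain R] {k : Type*} [Field k]
    [CharZero k] [Algebra k R] [Algebra.FiniteType k R] (hf0 : algebraMap R K f ≠ 0) (hn : IsUnit n)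
    (hD : IsLocallyNilpotentDerivation D) (hδf : δ (algebraMap R K f) = 0)
    (hDδ : Function.Semiconj (algebraMap _ K) D δ) :
    ∃ N : ℕ, ∀ r, algebraMap R K f ^ N * δ (algebraMap R K r) ∈ (algebraMap R K).range := by
  let P := SetLike.GradeZero.subring (awayPiece K hf)
  let _ : Algebra k P := ((algebraMap R K).comp (algebraMap k R) |>.codRestrict P fun c =>
    algebraMap_mem_awayPiece hf (algebraMap_mem_degree_zero c)).toAlgebra
  have : CharZero P := charZero_of_injective_algebraMap (algebraMap k P).injective
  refine exists_pow_mul_derivation_mem_range (k := k) (fun c => ?_) fun r => ?_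
  · refine (hDδ (algebraMap k P c)).symm.trans ?_
    rw [hD.apply_algebraMap_eq_zero, map_zero]
  · induction r using DirectSum.Decomposition.inductionOn ℛ with
    | zero => exact ⟨0, by simp⟩
    | homogeneous r =>
      obtain ⟨N, b, -, hb⟩ := derivation_mem_awayPiece hf0 hn hδf hDδ
        (algebraMap_mem_awayPiece (K := K) hf r.2)
      exact ⟨N, b, by rw [mul_comm, hb]⟩
    | add x y hx hy =>
      obtain ⟨M, a, ha⟩ := hx
      obtain ⟨N, b, hb⟩ := hy
      refine ⟨M + N, a * f ^ N + b * f ^ M, ?_⟩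
      simp only [map_add, map_mul, map_pow, ha, hb]
      ring

end Extension

theorem not_isRigidRing_of_isPolynomialRingInOneVariable_away [IsDomain R] (k : Type*) [Field k]
    [CharZero k] [Algebra k R] [Algebra.FiniteType k R] (hf : f ∈ ℛ n) (hf0 : f ≠ 0)
    (hn : IsUnit n) (hpoly : IsPolynomialRingInOneVariable (HomogeneousLocalization.Away ℛ f)) :
    ¬ IsRigidRing R := by
  obtain ⟨K, _, _, _⟩ : ∃ (K : Type _) (_ : Field K) (_ : Algebra R K), IsFractionRing R K :=
    ⟨FractionRing R, inferInstance, inferInstance, inferInstance⟩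
  have hinj := FaithfulSMul.algebraMap_injective R K
  have : CharZero K := charZero_of_injective_ringHom
    ((algebraMap R K).comp (algebraMap k R)).injective
  have hf0' : algebraMap R K f ≠ 0 := (map_ne_zero_iff _ hinj).2 hf0
  obtain ⟨A, ⟨e⟩⟩ := (isPolynomialRingInOneVariable_away_iff K hf hf0).1 hpoly
  obtain ⟨D, hD, hD0⟩ := exists_isLocallyNilpotentDerivation_ne_zero e.toRingEquiv
  obtain ⟨δ, hδf, hDδ⟩ := exists_derivation_extending_of_transcendental
    (transcendental_of_degree_ne_zero hf0' hn.ne_zero) (isAlgebraic_adjoin_degree_zero hf0' hn) D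
  obtain ⟨N, hN⟩ := exists_pow_mul_derivation_mem_range_of_semiconj (k := k) hf0' hn hD hδf hDδ
  obtain ⟨E, hE⟩ := exists_derivation_semiconj (E := algebraMap R K f ^ N • δ) hinj hN
  have hc : δ (algebraMap R K f ^ N) = 0 := by
    rw [δ.leibniz_pow, hδf, smul_zero, smul_zero]
  have hnilpotent : IsLocallyNilpotentDerivation E :=
    isLocallyNilpotentDerivation_of_homogeneous ℛ fun i x hx => by
      obtain ⟨m, hm⟩ := exists_iterate_eq_zero_of_semiconj_degree_zero hf0' hn hD hδf hDδ
        (algebraMap_mem_awayPiece (K := K) hf hx)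
      refine ⟨m, hinj ?_⟩
      rw [(hE.iterate_right m).eq, iterate_smul_derivation hc, hm, mul_zero, map_zero]
  intro hrigid
  have hδR : ∀ r, δ (algebraMap R K r) = 0 := fun r => by
    have hr := hE r
    rw [hrigid E hnilpotent, Derivation.zero_apply, map_zero] at hr
    exact (mul_eq_zero.1 hr.symm).resolve_left (pow_ne_zero N hf0')
  refine hD0 (Derivation.ext fun p => Subtype.ext ((hDδ p).trans ?_))
  have := IsLocalization.isAlgebraic K (nonZeroDivisors R)
  exact apply_eq_zero_of_isAlgebraic hδR (Algebra.IsAlgebraic.isAlgebraic _)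

end CylinderDerivation

theorem IsCylindrical.exists_not_isRigidRing_veroneseSubring (k : Type*) {B : Type*} [Field k]
    [CharZero k] [CommRing B] [IsDomain B] [Algebra k B] [Algebra.FiniteType k B]
    {𝒜 : ℤ → AddSubgroup B} [GradedRing 𝒜] {f : B} (h : IsCylindrical 𝒜 f) :
    ∃ d : ℕ, 1 ≤ d ∧ ¬ IsRigidRing (veroneseSubring 𝒜 d) := by
  obtain ⟨hf0, ⟨n, hn, hf⟩, hpoly⟩ := h
  have hd : 1 ≤ n.natAbs := Int.natAbs_pos.2 hn
  have : NeZero (n.natAbs : ℤ) := ⟨by omega⟩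
  let _ := veroneseAlgebra 𝒜 k (n.natAbs : ℤ)
  have := veroneseSubring_finiteType 𝒜 k hd
  have hdegree : (n.natAbs : ℤ) * n.sign = n := by
    rw [mul_comm, Int.sign_mul_natAbs]
  let f' : veroneseSubring 𝒜 n.natAbs :=
    ⟨f, mem_veroneseSubring_of_dvd 𝒜 ⟨_, hdegree.symm⟩ hf⟩
  have hf' : f' ∈ veroneseGrading 𝒜 n.natAbs n.sign := by
    rw [mem_veroneseGrading, hdegree]
    exact hf
  have hf0' : f' ≠ 0 := fun h => hf0 (congrArg Subtype.val h)
  exact ⟨n.natAbs, hd, not_isRigidRing_of_isPolynomialRingInOneVariable_away k hf' hf0'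
    (Int.isUnit_iff_natAbs_eq.2 (Int.natAbs_sign_of_ne_zero hn))
    ((isPolynomialRingInOneVariable_away_veronese_iff hf' hf0').2 hpoly)⟩

section HeightOnePrimes

variable {B K : Type*} [CommRing B] [IsNoetherianRing B] [IsIntegrallyClosed B]
  [Field K] [Algebra B K] [IsFractionRing B K]

/-- Otherwise `y` would map the finitely generated ideal `P` into itself, hence be integral. -/
theorem exists_notMem_algebraMap_eq_smul {P : Ideal B} (hP : P ≠ ⊥) {y : K}
    (hy : y ∉ (algebraMap B K).range) (hPy : ∀ c ∈ P, c • y ∈ (algebraMap B K).range) :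
    ∃ c ∈ P, ∃ u ∉ P, algebraMap B K u = c • y := by
  by_contra! hstable
  suffices hint : IsIntegral B y from hy (IsIntegrallyClosed.algebraMap_eq_of_integral hint)
  refine isIntegral_of_smul_mem_submodule (Submodule.map (Algebra.linearMap B K) P) ?_
    ((IsNoetherian.noetherian P).map _) y ?_
  · rwa [Ne, ← Submodule.map_bot (Algebra.linearMap B K),
      (Submodule.map_injective_of_injective (FaithfulSMul.algebraMap_injective B K)).eq_iff]
  · rintro _ ⟨c, hc, rfl⟩
    obtain ⟨u, hu⟩ := hPy c hc
    refine ⟨u, of_not_not fun huP => hstable c hc u huP hu, ?_⟩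
    rw [Algebra.linearMap_apply, Algebra.linearMap_apply, hu, Algebra.smul_def, smul_eq_mul,
      mul_comm]

variable [IsDomain B]

theorem height_eq_one_of_isAssociatedPrime {P : Ideal B}
    (hP : IsAssociatedPrime P (K ⧸ LinearMap.range (Algebra.linearMap B K))) : P.height = 1 := by
  obtain ⟨hprime, y', hPy⟩ := isAssociatedPrime_iff.1 hP
  obtain ⟨y, rfl⟩ := Submodule.Quotient.mk_surjective _ y'
  have hmem : ∀ c, c ∈ P ↔ c • y ∈ (algebraMap B K).range := fun c => by
    rw [hPy, Submodule.mem_colon_singleton, Submodule.mem_bot]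
    exact Submodule.Quotient.mk_eq_zero _
  have hne : P ≠ ⊥ := by
    obtain ⟨a, c, hc, rfl⟩ := IsFractionRing.div_surjective (A := B) y
    refine (Submodule.ne_bot_iff _).2 ⟨c, (hmem c).2 ⟨a, ?_⟩, nonZeroDivisors.ne_zero hc⟩
    rw [Algebra.smul_def, mul_div_cancel₀]
    exact IsFractionRing.to_map_ne_zero_of_mem_nonZeroDivisors hc
  have hy : y ∉ (algebraMap B K).range := fun hy =>
    hprime.ne_top ((Ideal.eq_top_iff_one _).2 ((hmem 1).2 (by rwa [one_smul])))
  obtain ⟨c, hc, u, hu, hcu⟩ := exists_notMem_algebraMap_eq_smul hne hy fun c => (hmem c).1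
  refine le_antisymm ?_ (Order.one_le_iff_ne_zero.2 (Ideal.height_eq_zero_iff_eq_bot.not.2 hne))
  refine Ideal.height_le_one_of_isPrincipal_of_mem_minimalPrimes (Ideal.span {c}) P
    ⟨⟨hprime, (Ideal.span_singleton_le_iff_mem _).2 hc⟩, fun Q ⟨hQ, hcQ⟩ hQP a ha => ?_⟩
  obtain ⟨v, hv⟩ := (hmem a).1 ha
  have hrel : a * u = v * c := FaithfulSMul.algebraMap_injective B K <| by
    rw [map_mul, map_mul, hv, hcu, Algebra.smul_def, Algebra.smul_def]
    ring
  refine (hQ.mem_or_mem (?_ : a * u ∈ Q)).resolve_right fun h => hu (hQP h)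
  exact hrel ▸ Ideal.mul_mem_left _ _ ((Ideal.span_singleton_le_iff_mem _).1 hcQ)

theorem exists_height_eq_one_of_notMem_range {x : K} (hx : x ∉ (algebraMap B K).range) :
    ∃ p : Ideal B, p.IsPrime ∧ p.height = 1 ∧
      ∀ c : B, c • x ∈ (algebraMap B K).range → c ∈ p := by
  obtain ⟨p, hp, hle⟩ := exists_le_isAssociatedPrime_of_isNoetherianRing B
    (Submodule.Quotient.mk (p := LinearMap.range (Algebra.linearMap B K)) x)
    fun h => hx ((Submodule.Quotient.mk_eq_zero _).1 h)
  refine ⟨p, hp.isPrime, height_eq_one_of_isAssociatedPrime hp, fun c hc => hle ?_⟩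
  rw [Submodule.mem_colon_singleton, Submodule.mem_bot]
  exact (Submodule.Quotient.mk_eq_zero _).2 hc

end HeightOnePrimes

section Saturation

variable {B : Type*} [CommRing B]

theorem mem_span_degrees_iff (𝒜 : ℤ → AddSubgroup B) {i : ℤ} :
    i ∈ Ideal.span {j : ℤ | 𝒜 j ≠ ⊥} ↔ (saturationIndex 𝒜 : ℤ) ∣ i := by
  rw [saturationIndex, Int.natAbs_dvd, ← Ideal.mem_span_singleton, Ideal.span_singleton_generator]

theorem quotientGrading_ne_bot_iff {𝒜 : ℤ → AddSubgroup B} {p : Ideal B} {i : ℤ} :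
    quotientGrading 𝒜 p i ≠ ⊥ ↔ ∃ z ∈ 𝒜 i, z ∉ p := by
  simp [quotientGrading, AddSubgroup.eq_bot_iff_forall, Ideal.Quotient.eq_zero_iff_mem]

theorem exists_notMem_modEq_of_mem_span {𝒜 : ℤ → AddSubgroup B} [SetLike.GradedMonoid 𝒜]
    {p : Ideal B} (hp : p.IsPrime) {d : ℕ} (hd : 1 ≤ d) {i : ℤ}
    (hi : i ∈ Ideal.span {j : ℤ | quotientGrading 𝒜 p j ≠ ⊥}) :
    ∃ j, ∃ z ∈ 𝒜 j, z ∉ p ∧ j ≡ i [ZMOD d] := by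
  induction hi using Submodule.span_induction with
  | mem i hi =>
    obtain ⟨z, hz, hzp⟩ := quotientGrading_ne_bot_iff.1 hi
    exact ⟨i, z, hz, hzp, rfl⟩
  | zero => exact ⟨0, 1, SetLike.GradedOne.one_mem, hp.one_notMem, rfl⟩
  | add a b _ _ ha hb =>
    obtain ⟨j, z, hz, hzp, hj⟩ := ha
    obtain ⟨l, w, hw, hwp, hl⟩ := hb
    exact ⟨j + l, z * w, SetLike.GradedMul.mul_mem hz hw, hp.mul_notMem hzp hwp, hj.add hl⟩
  | smul a b _ hb =>
    obtain ⟨j, z, hz, hzp, hj⟩ := hb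
    lift a % d to ℕ using Int.emod_nonneg a (by omega) with m hm
    refine ⟨_, z ^ m, SetLike.pow_mem_graded m hz, fun h => hzp (hp.mem_of_pow_mem m h), ?_⟩
    rw [nsmul_eq_mul, hm, smul_eq_mul]
    exact Int.ModEq.mul (Int.mod_modEq a d) hj

variable {𝒜 : ℤ → AddSubgroup B} [GradedRing 𝒜]

theorem notMem_of_height_eq_one_of_not_isHomogeneous [IsDomain B] {p : Ideal B} (hp : p.IsPrime)
    (hheight : p.height = 1) (hhom : ¬ p.IsHomogeneous 𝒜) {z : B}
    (hz : SetLike.IsHomogeneousElem 𝒜 z) (hz0 : z ≠ 0) : z ∉ p := by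
  have hprime := hp.homogeneousCore (𝒜 := 𝒜)
  have hlt : (p.homogeneousCore 𝒜).toIdeal < p :=
    (Ideal.toIdeal_homogeneousCore_le 𝒜 p).lt_of_ne fun h =>
      hhom (h ▸ (p.homogeneousCore 𝒜).isHomogeneous)
  have hbot : (p.homogeneousCore 𝒜).toIdeal = ⊥ := by
    have h := Ideal.height_add_one_le_of_lt_of_isPrime hlt
    rw [hheight, ENat.add_one_le_iff' ENat.one_ne_top] at h
    exact Ideal.height_eq_zero_iff_eq_bot.1 (Order.lt_one_iff.1 h)
  intro hzp
  have hmem : z ∈ (p.homogeneousCore 𝒜).toIdeal :=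
    Ideal.mem_homogeneousCore_of_homogeneous_of_mem hz hzp
  rw [hbot] at hmem
  exact hz0 ((Submodule.mem_bot B).1 hmem)

theorem IsSaturatedInCodimOne.exists_notMem_dvd_add [IsDomain B] (hsat : IsSaturatedInCodimOne 𝒜)
    {p : Ideal B} (hp : p.IsPrime) (hheight : p.height = 1) {d : ℕ} (hd : 1 ≤ d) {i : ℤ} {b : B}
    (hb : b ∈ 𝒜 i) (hb0 : b ≠ 0) : ∃ j, ∃ z ∈ 𝒜 j, z ∉ p ∧ (d : ℤ) ∣ i + j := by
  by_cases hhom : p.IsHomogeneous 𝒜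
  · have hi : -i ∈ Ideal.span {j : ℤ | quotientGrading 𝒜 p j ≠ ⊥} := by
      rw [neg_mem_iff, mem_span_degrees_iff, hsat p hp hhom hheight, ← mem_span_degrees_iff]
      exact Ideal.subset_span fun h => hb0 (by simpa [h] using hb)
    obtain ⟨j, z, hz, hzp, hj⟩ := exists_notMem_modEq_of_mem_span hp hd hi
    exact ⟨j, z, hz, hzp, by simpa [add_comm] using hj.symm.dvd⟩
  · have hz := SetLike.pow_mem_graded (d - 1) hb
    refine ⟨_, b ^ (d - 1), hz, notMem_of_height_eq_one_of_not_isHomogeneous hp hheight hhom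
      ⟨_, hz⟩ (pow_ne_zero _ hb0), i, ?_⟩
    rw [nsmul_eq_mul, Nat.cast_sub hd]
    push_cast
    ring

theorem smul_derivation_algebraMap_mem_range {S : Type*} [CommRing S] [Algebra B S]
    {δ : Derivation ℤ S S} {b z : B} {d : ℕ}
    (hbz : δ (algebraMap B S (b * z)) ∈ (algebraMap B S).range)
    (hz : δ (algebraMap B S (z ^ d)) ∈ (algebraMap B S).range) :
    ((d : B) * z ^ d) • δ (algebraMap B S b) ∈ (algebraMap B S).range := by
  obtain ⟨u, hu⟩ := hbz
  obtain ⟨v, hv⟩ := hz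
  refine ⟨d * z ^ (d - 1) * u - b * v, ?_⟩
  rw [Algebra.smul_def, map_sub, map_mul, map_mul _ b, hu, hv, map_pow, Derivation.leibniz_pow,
    map_mul _ b z, Derivation.leibniz]
  cases d with
  | zero => simp
  | succ d =>
    simp only [map_mul, map_pow, map_natCast, smul_eq_mul, nsmul_eq_mul, Nat.add_sub_cancel]
    ring

theorem IsSaturatedInCodimOne.derivation_mem_range [IsDomain B] [IsNoetherianRing B]
    [IsIntegrallyClosed B] {K : Type*} [Field K] [Algebra B K] [IsFractionRing B K]
    (hsat : IsSaturatedInCodimOne 𝒜) {d : ℕ} (hd : IsUnit (d : B)) {δ : Derivation ℤ K K}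
    (hδ : ∀ v ∈ veroneseSubring 𝒜 d, δ (algebraMap B K v) ∈ (algebraMap B K).range) (b : B) :
    δ (algebraMap B K b) ∈ (algebraMap B K).range := by
  have hd1 : 1 ≤ d := Nat.one_le_iff_ne_zero.2 fun h => hd.ne_zero (by rw [h, Nat.cast_zero])
  induction b using DirectSum.Decomposition.inductionOn 𝒜 with
  | zero => simp
  | add x y hx hy => simpa using add_mem hx hy
  | @homogeneous i b =>
    by_contra hb
    have hb0 : (b : B) ≠ 0 := fun h => hb (by simp [h])
    obtain ⟨p, hp, hheight, hdenominator⟩ := exists_height_eq_one_of_notMem_range hb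
    obtain ⟨j, z, hz, hzp, hij⟩ := hsat.exists_notMem_dvd_add hp hheight hd1 b.2 hb0
    refine (hp.mem_or_mem (hdenominator _ (smul_derivation_algebraMap_mem_range
      (hδ _ (mem_veroneseSubring_of_dvd 𝒜 hij (SetLike.GradedMul.mul_mem b.2 hz)))
      (hδ _ (pow_mem_veroneseSubring 𝒜 hz))))).elim (fun h => ?_) fun h => ?_
    · exact hp.ne_top (p.eq_top_of_isUnit_mem h hd)
    · exact hzp (hp.mem_of_pow_mem d h)

theorem isLocallyNilpotentDerivation_of_semiconj_veroneseSubring [IsDomain B] [CharZero B] {d : ℕ}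
    (hd : d ≠ 0) {e : ℤ} {D : Derivation ℤ B B}
    {E : Derivation ℤ (veroneseSubring 𝒜 d) (veroneseSubring 𝒜 d)}
    (hED : Function.Semiconj (veroneseSubring 𝒜 d).subtype E D)
    (hE : IsLocallyNilpotentDerivation E)
    (hhom : IsHomogeneousDerivation (veroneseGrading 𝒜 d) E e) :
    IsLocallyNilpotentDerivation D := by
  have hpow : ∀ {i : ℤ} {x : B}, x ∈ 𝒜 i → D (x ^ d) ∈ 𝒜 (d * (i + e)) := by
    intro i x hx
    have hmem := SetLike.pow_mem_graded d hx
    rw [nsmul_eq_mul] at hmem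
    have h := hhom i ⟨_, pow_mem_veroneseSubring 𝒜 hx⟩ hmem
    exact hED ⟨x ^ d, _⟩ ▸ h
  have hstable : ∀ x, SetLike.IsHomogeneousElem 𝒜 x → SetLike.IsHomogeneousElem 𝒜 (D x) := by
    rintro x ⟨i, hx⟩
    by_cases h0 : D x * (d * x ^ (d - 1)) = 0
    · have hDx : D x = 0 := by
        by_contra hDx
        have hpow0 : x ^ (d - 1) = 0 := by simpa [hDx, hd, -pow_eq_zero_iff'] using h0
        exact hDx (by rw [eq_zero_of_pow_eq_zero hpow0, map_zero])
      exact ⟨0, hDx ▸ zero_mem _⟩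
    · refine isHomogeneousElem_of_mul ⟨d * (i + e), ?_⟩ h0
      have h := hpow hx
      rwa [Derivation.leibniz_pow, nsmul_eq_mul, smul_eq_mul, ← mul_assoc, mul_comm _ (D x)] at h
  have hnilpotent := exists_iterate_eq_zero_of_pow hd
    (T := {x | SetLike.IsHomogeneousElem 𝒜 x}) hstable fun x ⟨i, hx⟩ => by
      obtain ⟨n, -, hn⟩ := hE ⟨_, pow_mem_veroneseSubring 𝒜 hx⟩
      exact ⟨n, ((hED.iterate_right n).eq _).symm.trans (by rw [hn, map_zero])⟩
  exact isLocallyNilpotentDerivation_of_homogeneous 𝒜 fun i x hx => hnilpotent x ⟨i, hx⟩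

theorem IsSaturatedInCodimOne.not_isRigidRing (k : Type*) [Field k] [CharZero k] [IsDomain B]
    [Algebra k B] [Algebra.FiniteType k B] [IsIntegrallyClosed B]
    (hsat : IsSaturatedInCodimOne 𝒜) {d : ℕ} (hd : 1 ≤ d)
    (hrigid : ¬ IsRigidRing (veroneseSubring 𝒜 d)) : ¬ IsRigidRing B := by
  let V := veroneseSubring 𝒜 d
  obtain ⟨K, _, _, _⟩ : ∃ (K : Type _) (_ : Field K) (_ : Algebra B K), IsFractionRing B K :=
    ⟨FractionRing B, inferInstance, inferInstance, inferInstance⟩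
  have hinj := FaithfulSMul.algebraMap_injective B K
  have : IsNoetherianRing B := Algebra.FiniteType.isNoetherianRing k B
  have : CharZero B := charZero_of_injective_algebraMap (algebraMap k B).injective
  have : NeZero (d : ℤ) := ⟨by omega⟩
  let _ := veroneseAlgebra 𝒜 k d
  have := veroneseSubring_finiteType 𝒜 k hd
  have := veroneseSubring_isIntegral 𝒜 hd
  have : Algebra.IsAlgebraic B K := IsLocalization.isAlgebraic K (nonZeroDivisors B)
  have : Algebra.IsAlgebraic V K := Algebra.IsAlgebraic.trans V B K
  have : CharZero V := charZero_of_injective_algebraMap (algebraMap k V).injective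
  have : FaithfulSMul V K :=
    (faithfulSMul_iff_algebraMap_injective V K).2 (hinj.comp Subtype.val_injective)
  obtain ⟨E₀, hE₀, hE₀0⟩ : ∃ E : Derivation ℤ V V, IsLocallyNilpotentDerivation E ∧ E ≠ 0 := by
    simpa [IsRigidRing] using hrigid
  obtain ⟨e, E, hE0, hE, hhom⟩ := hE₀.exists_homogeneous (veroneseGrading 𝒜 d) (k := k) hE₀0
  obtain ⟨δ, hδ⟩ := exists_semiconj_derivation_of_isAlgebraic (K := K) E
  have hunit : IsUnit (d : B) := by
    simpa using (Nat.cast_ne_zero.2 (by omega : d ≠ 0) : (d : k) ≠ 0).isUnit.map (algebraMap k B)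
  obtain ⟨D, hD⟩ := exists_derivation_semiconj hinj <|
    hsat.derivation_mem_range hunit fun v hv => ⟨E ⟨v, hv⟩, hδ ⟨v, hv⟩⟩
  have hED : Function.Semiconj V.subtype E D := fun v => hinj ((hδ v).trans (hD v).symm)
  have hDlnd := isLocallyNilpotentDerivation_of_semiconj_veroneseSubring (by omega) hED hE hhom
  refine fun hB => hE0 (Derivation.ext fun v => Subtype.ext ((hED v).trans ?_))
  rw [hB D hDlnd, Derivation.zero_apply, Derivation.zero_apply, ZeroMemClass.coe_zero]

end Saturation

theorem mainTheorem1 {k B : Type*} [Field k] [CharZero k] [CommRing B] [IsDomain B]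
    [Algebra k B] [Algebra.FiniteType k B] (𝒜 : ℤ → AddSubgroup B) [GradedRing 𝒜]
    (hB : 2 ≤ Algebra.trdeg (SetLike.GradeZero.subring 𝒜) B ∨
      ∃ i j : ℤ, i < 0 ∧ 0 < j ∧ 𝒜 i ≠ ⊥ ∧ 𝒜 j ≠ ⊥) :
    ((∃ d : ℕ, 1 ≤ d ∧ ¬ IsRigidRing (veroneseSubring 𝒜 d)) ↔ ∃ f : B, IsCylindrical 𝒜 f) ∧
    (IsSaturatedInCodimOne 𝒜 → IsIntegrallyClosed B →
      List.TFAE [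
        ∃ d : ℕ, 1 ≤ d ∧ ¬ IsRigidRing (veroneseSubring 𝒜 d),
        ∃ f : B, IsCylindrical 𝒜 f,
        ¬ IsRigidRing B]) := by
  have hab : (∃ d : ℕ, 1 ≤ d ∧ ¬ IsRigidRing (veroneseSubring 𝒜 d)) →
      ∃ f : B, IsCylindrical 𝒜 f :=
    fun ⟨_, hd, h⟩ => exists_isCylindrical_of_not_isRigidRing 𝒜 k hB hd h
  have hba : (∃ f : B, IsCylindrical 𝒜 f) →
      ∃ d : ℕ, 1 ≤ d ∧ ¬ IsRigidRing (veroneseSubring 𝒜 d) :=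
    fun ⟨_, hf⟩ => hf.exists_not_isRigidRing_veroneseSubring k
  refine ⟨⟨hab, hba⟩, fun hsat hnormal => ?_⟩
  tfae_have 1 → 2 := hab
  tfae_have 2 → 1 := hba
  tfae_have 1 → 3 := fun ⟨_, hd, h⟩ => hsat.not_isRigidRing k hd h
  tfae_have 3 → 1 := fun h => ⟨1, le_rfl, fun hrigid => h <| hrigid.of_ringEquiv <|
    (RingEquiv.subringCongr (veroneseSubring_one 𝒜)).trans Subring.topEquiv⟩
  tfae_finish
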